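/- Let $a\ge b>0$ and $r>0$. Fix a circle $C_0$ of radius $r$ in the plane, bounding the closed disk $K_0$. A position of an oriented ellipse $C_1$ with semi-axes $a,b$, bounding the closed region $K_1$, is given by its centre $(x_1,y_1)\in\mathbb R^2$ and the angle $\psi\in[0,2\pi)$ from a fixed direction to the first axis of a frame attached to $C_1$ (origin at the centre, first axis along a semi-axis of length $a$); positions are measured by the kinematic measure $m=dx_1\,dy_1\,d\psi$. Let $\#(C_0\cap C_1)$ be the number of (real) intersection points counted with multiplicity. Put $\varepsilon=\sqrt{a^2-b^2}/a$, $E(\varphi,\varepsilon)=\int_0^{\varphi}\sqrt{1-\varepsilon^2\sin^2\theta}\,d\theta$, $E(\varepsilon)=E(\pi/2,\varepsilon)$, $$F(\varphi)=2r^2\varphi+2ab\arctan\Bigl(\frac ba\tan\varphi\Bigr)-4raE(\varphi,\varepsilon)+\frac{ra\varepsilon^2\sin2\varphi}{\sqrt{1-\varepsilon^2\sin^2\varphi}},\qquad A^*=\pi r^2+\pi ab-4raE(\varepsilon),$$ $$\alpha=\arctan\frac{\sqrt{r^2a^2-b^4}}{b\sqrt{b^2-r^2}},\qquad \beta=\arctan\frac{a\sqrt{r^2-a^2}}{\sqrt{a^4-r^2b^2}},$$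 $$A_i^{10}=\begin{cases}0&r\le a\\ F(\beta)&a<r<a^2/b\\ A^*&r>a,\ r\ge a^2/b\end{cases}\qquad A_i^{01}=\begin{cases}A^*&r<b,\ r\le b^2/a\\ A^*-F(\alpha)&b^2/a<r<b\\ 0&r\ge b.\end{cases}$$ Then for every fixed direction $\psi$ the set of centres for which $C_1\subset K_0$ has area $A_i^{10}$, and the set of centres for which $C_0\subset K_1$ has area $A_i^{01}$; the corresponding kinematic measures over all directions are $m(\{C_1: C_1\subset K_0\})=2\pi A_i^{10}$ and $m(\{C_1: C_0\subset K_1\})=2\pi A_i^{01}$. Let $m_i=2\pi A_i^{10}$ if $r>a$, $m_i=0$ if $b\le r\le a$, and $m_i=2\pi A_i^{01}$ if $r<b$. Then $$m(\{C_1:\#(C_0\cap C_1)=2\})=4\pi^2r^2+4\pi^2ab-2m_i,$$ $$m(\{C_1:\#(C_0\cap C_1)=4\})=8\pi raE(\varepsilon)-2\pi^2r^2-2\pi^2ab+m_i .$$ -/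

import Mathlib

open Set MeasureTheory

noncomputable section

/-- The Euclidean plane is `ℂ`. A position of an oriented ellipse is `p = (M, ψ)`, where `M` is the
centre and `ψ` the angle from the `x`-axis of the plane to the axis of the moving frame along the semi-axis `a`.
`ellipsePoint a b p t` is the usual parametrization, with semi-axes `a` and `b`. -/
def ellipsePoint (a b : ℝ) (p : ℂ × ℝ) (t : ℝ) : ℂ :=
  p.1 + Complex.exp (p.2 * Complex.I) * (⟨a * Real.cos t, b * Real.sin t⟩ : ℂ)

/-- The ellipse (the curve) in position `p`. -/
def ellipseCurve (a b : ℝ) (p : ℂ × ℝ) : Set ℂ :=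
  Set.range (ellipsePoint a b p)

/-- The closed region bounded by the ellipse in position `p`. -/
def ellipseRegion (a b : ℝ) (p : ℂ × ℝ) : Set ℂ :=
  (fun w : ℂ => p.1 + Complex.exp (p.2 * Complex.I) * w) ''
    {w : ℂ | (w.re / a) ^ 2 + (w.im / b) ^ 2 ≤ 1}

/-- The number of real intersection points, counted with multiplicity, of the ellipse in
position `p` with the circle of centre `c` and radius `r`. The multiplicity at the point of the
ellipse with parameter `t` is the order of vanishing at `t` of the equation of the circle,
restricted to the ellipse (it is `0` off the circle); each point of the ellipse has exactly one
parameter in `[0, 2π)`. The value is `⊤` if the two curves coincide. -/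
def intersectionNumber (a b r : ℝ) (c : ℂ) (p : ℂ × ℝ) : ℕ∞ :=
  ∑' t : Set.Ico (0 : ℝ) (2 * Real.pi),
    analyticOrderAt (fun s : ℝ => Complex.normSq (ellipsePoint a b p s - c) - r ^ 2) (t : ℝ)

/-- The kinematic measure `dx ∧ dy ∧ dψ` on positions, with `ψ` in `[0, 2π)`. -/
def kinematicMeasure : Measure (ℂ × ℝ) :=
  (volume : Measure ℂ).prod ((volume : Measure ℝ).restrict (Set.Ico 0 (2 * Real.pi)))

/-- `S` is measurable up to a null set and has the finite measure `v`. -/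
def HasMeasure {X : Type*} [MeasurableSpace X] (μ : Measure X) (S : Set X) (v : ℝ) : Prop :=
  NullMeasurableSet S μ ∧ μ S ≠ ⊤ ∧ (μ S).toReal = v

/-- The eccentricity of the ellipse with semi-axes `a ≥ b`. -/
def eccentricity (a b : ℝ) : ℝ := Real.sqrt (a ^ 2 - b ^ 2) / a

/-- The incomplete elliptic integral of the second kind `E(φ, ε)`, with modulus `ε`. -/
def ellipticE (φ ε : ℝ) : ℝ :=
  ∫ θ in (0 : ℝ)..φ, Real.sqrt (1 - ε ^ 2 * Real.sin θ ^ 2)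

/-- The complete elliptic integral of the second kind `E(ε)`. -/
def completeE (ε : ℝ) : ℝ := ellipticE (Real.pi / 2) ε

/-- The function `F(φ)`, used only for `0 < φ < π / 2`. -/
def areaF (a b r φ : ℝ) : ℝ :=
  2 * r ^ 2 * φ + 2 * a * b * Real.arctan (b / a * Real.tan φ)
    - 4 * r * a * ellipticE φ (eccentricity a b)
    + r * a * eccentricity a b ^ 2 * Real.sin (2 * φ)
      / Real.sqrt (1 - eccentricity a b ^ 2 * Real.sin φ ^ 2)

/-- `A* = π r² + π a b - 4 r a E(ε)`. -/
def areaStar (a b r : ℝ) : ℝ :=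
  Real.pi * r ^ 2 + Real.pi * a * b - 4 * r * a * completeE (eccentricity a b)

/-- The angle `α`, for `b² / a < r < b`. -/
def angleAlpha (a b r : ℝ) : ℝ :=
  Real.arctan (Real.sqrt (r ^ 2 * a ^ 2 - b ^ 4) / (b * Real.sqrt (b ^ 2 - r ^ 2)))

/-- The angle `β`, for `a < r < a² / b`. -/
def angleBeta (a b r : ℝ) : ℝ :=
  Real.arctan (a * Real.sqrt (r ^ 2 - a ^ 2) / Real.sqrt (a ^ 4 - r ^ 2 * b ^ 2))

/-- The formula for the area of the positions with fixed direction in which the ellipse lies in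
the disk. -/
def areaEllipseInDisk (a b r : ℝ) : ℝ :=
  if r ≤ a then 0
  else if r < a ^ 2 / b then areaF a b r (angleBeta a b r)
  else areaStar a b r

/-- The formula for the area of the positions with fixed direction in which the circle lies in
the region bounded by the ellipse. -/
def areaCircleInEllipse (a b r : ℝ) : ℝ :=
  if b ≤ r then 0
  else if b ^ 2 / a < r then areaStar a b r - areaF a b r (angleAlpha a b r)
  else areaStar a b r

/-- The quantity `mᵢ`. -/
def containmentMeasure (a b r : ℝ) : ℝ :=
  if a < r then 2 * Real.pi * areaEllipseInDisk a b r
  else if b ≤ r then 0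
  else 2 * Real.pi * areaCircleInEllipse a b r

end

/-! Seen from the frame attached to the ellipse with origin `c`, a position matters only through the
centre `relativeCentre c p`. For fixed direction the passage to this frame is an isometry, so each
kinematic measure is `2 * π` times an area computed in direction `0` with the circle about the
origin.

Let `v₂` and `v₄` be the areas of the sets of centres with contact number 2 and 4. Centres of
tangent ellipses are critical values of `contactMap`, hence null (`volume_tangencySet`). Off them
every contact is simple, there are at most four since contacts are roots of a quartic, and their
number is even by periodicity (`ncard_zeros_contactFun`). Two linear equations then determine `v₂`
and `v₄`.

The area formula for `contactMap` (`exists_measurable_encard_fiber`) gives `2 v₂ + 4 v₄` as the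
integral of a Jacobian, which is `4 r` times the perimeter of the ellipse: Poincaré's formula. On
the other hand `v₂ + v₄` is the area of the centres whose ellipse meets the circle. This is the area
of the Minkowski sum of disk and elliptic region, minus the areas of the two containment sets
(`volume_hitSet_add`).

These three sets are cut out by support inequalities with right-hand sides `H + r`, `r - H` and `H -
r`, where `H` is the support function of the ellipse. Where such a set is not null, its boundary
consists of arcs of a parallel curve of the ellipse, parametrized by the normal angle.
`hasMeasure_supportSet` turns its area into an integral, and `hasDerivAt_areaF` evaluates that
integral by `F`. The angles `α` and `β` mark where the parallel curve crosses an axis and the rest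
of its quarter must be dropped. -/

noncomputable section

/-! ### Areas of planar sets given by support inequalities -/

/-- The intersection of the half-planes with outer normal `(cos η, sin η)` and distance `p η`. -/
def supportSet (p : ℝ → ℝ) : Set (ℝ × ℝ) :=
  {z | ∀ η, z.1 * Real.cos η + z.2 * Real.sin η ≤ p η}

theorem isClosed_supportSet (p : ℝ → ℝ) : IsClosed (supportSet p) := by
  simp only [supportSet, Set.ofPred_forall]
  exact isClosed_iInter fun η => isClosed_le (by fun_prop) continuous_const

theorem neg_snd_mem_supportSet {p : ℝ → ℝ} (hp : ∀ η, p (-η) = p η) {x y : ℝ}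
    (h : (x, y) ∈ supportSet p) : (x, -y) ∈ supportSet p := by
  intro η
  have := h (-η)
  simp only [Real.cos_neg, Real.sin_neg, hp] at this ⊢
  linarith

theorem neg_fst_mem_supportSet {p : ℝ → ℝ} (hp : ∀ η, p (Real.pi - η) = p η) {x y : ℝ}
    (h : (x, y) ∈ supportSet p) : (-x, y) ∈ supportSet p := by
  intro η
  have := h (Real.pi - η)
  simp only [Real.cos_pi_sub, Real.sin_pi_sub, hp] at this ⊢
  linarith

/-- The support line at `θ`, which passes through `(x, y)`, bounds the slice above; reflection in
the first axis bounds it below. In between, each inequality is linear in the ordinate, so it follows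
from the one at the endpoint chosen by the sign of `sin η`. -/
theorem supportSet_slice {p : ℝ → ℝ} (hp : ∀ η, p (-η) = p η) {x y θ : ℝ}
    (hθ : 0 < Real.sin θ) (hxy : x * Real.cos θ + y * Real.sin θ = p θ)
    (h : (x, y) ∈ supportSet p) : Prod.mk x ⁻¹' supportSet p = Icc (-y) y := by
  have key : ∀ z, (x, z) ∈ supportSet p → z ≤ y := by
    intro z hz
    have := hz θ
    simp only at this
    have h2 : z * Real.sin θ ≤ y * Real.sin θ := by linarith
    exact le_of_mul_le_mul_right h2 hθ
  ext z
  simp only [mem_preimage, mem_Icc]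
  refine ⟨fun hz => ⟨?_, key z hz⟩, fun hz η => ?_⟩
  · linarith [key _ (neg_snd_mem_supportSet hp hz)]
  · have h1 := h η
    have h2 := neg_snd_mem_supportSet hp h η
    simp only at h1 h2 ⊢
    rcases le_total 0 (Real.sin η) with hs | hs
    · nlinarith [mul_le_mul_of_nonneg_right hz.2 hs]
    · nlinarith [mul_le_mul_of_nonpos_right hz.1 hs]

theorem lintegral_eq_two_mul_of_even {f : ℝ → ENNReal} (hf : Measurable f)
    (hev : ∀ x, f (-x) = f x) : ∫⁻ x, f x = 2 * ∫⁻ x in Ioi 0, f x := by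
  have h1 : ∫⁻ x in Iic 0, f x = ∫⁻ x in Ioi 0, f x := by
    have := (Measure.measurePreserving_neg (volume : Measure ℝ)).setLIntegral_comp_preimage
      (s := Ici 0) measurableSet_Ici hf
    rw [← restrict_Ioi_eq_restrict_Ici] at this
    rw [← this]
    simp [hev]
  rw [← lintegral_add_compl f (measurableSet_Ioi (a := (0 : ℝ))), compl_Ioi, h1, two_mul]

/-- The area of a support set that is symmetric in both axes and whose boundary in the first
quadrant is a curve with the given normal angle. -/
theorem hasMeasure_supportSet {p X Y X' : ℝ → ℝ} {θ₀ θ₁ : ℝ} (hθ : θ₀ < θ₁) (hθ₀ : 0 ≤ θ₀)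
    (hθ₁ : θ₁ ≤ Real.pi / 2) (hp₁ : ∀ η, p (-η) = p η) (hp₂ : ∀ η, p (Real.pi - η) = p η)
    (hXY : ∀ θ, X θ * Real.cos θ + Y θ * Real.sin θ = p θ)
    (hX : ∀ θ, HasDerivAt X (X' θ) θ) (hX' : Continuous X') (hYc : Continuous Y)
    (hneg : ∀ θ ∈ Ioo θ₀ θ₁, X' θ < 0) (hY : ∀ θ ∈ Ioo θ₀ θ₁, 0 ≤ Y θ)
    (hmem : ∀ θ ∈ Ioo θ₀ θ₁, (X θ, Y θ) ∈ supportSet p)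
    (h₀ : Y θ₀ * Real.sin θ₀ = 0) (h₁ : X θ₁ = 0) :
    HasMeasure volume (supportSet p) (4 * ∫ θ in θ₀..θ₁, Y θ * (-X' θ)) := by
  have hnn : 0 ≤ ∫ θ in θ₀..θ₁, Y θ * (-X' θ) := by
    rw [intervalIntegral.integral_of_le hθ.le, integral_Ioc_eq_integral_Ioo]
    exact setIntegral_nonneg measurableSet_Ioo fun θ h =>
      mul_nonneg (hY θ h) (neg_nonneg.2 (hneg θ h).le)
  suffices hvol : volume (supportSet p) = ENNReal.ofReal (4 * ∫ θ in θ₀..θ₁, Y θ * (-X' θ)) by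
    refine ⟨(isClosed_supportSet p).measurableSet.nullMeasurableSet, ?_, ?_⟩
    · rw [hvol]; exact ENNReal.ofReal_ne_top
    · rw [hvol, ENNReal.toReal_ofReal (by positivity)]
  have hS := (isClosed_supportSet p).measurableSet
  have hXc : Continuous X := continuous_iff_continuousAt.2 fun θ => (hX θ).continuousAt
  have hanti : StrictAntiOn X (Icc θ₀ θ₁) := by
    refine strictAntiOn_of_deriv_neg (convex_Icc _ _) hXc.continuousOn fun θ h => ?_
    rw [interior_Icc] at h
    rw [(hX θ).deriv]
    exact hneg θ h
  have himg : X '' Ioo θ₀ θ₁ = Ioo 0 (X θ₀) := by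
    apply Subset.antisymm
    · rintro _ ⟨θ, h, rfl⟩
      rw [← h₁]
      exact ⟨hanti (Ioo_subset_Icc_self h) (right_mem_Icc.2 hθ.le) h.2,
        hanti (left_mem_Icc.2 hθ.le) (Ioo_subset_Icc_self h) h.1⟩
    · rw [← h₁]
      exact intermediate_value_Ioo' hθ.le hXc.continuousOn
  -- By `h₀` the support line at `θ₀` reads `X θ₀ * cos θ₀ = p θ₀`. Averaging the inequalities for
  -- `(x, y)` and `(x, -y)` bounds `x * cos θ₀` by this, so nothing lies to the right of `X θ₀`.
  have hempty : ∀ x, X θ₀ < x → Prod.mk x ⁻¹' supportSet p = ∅ := by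
    intro x hx
    refine eq_empty_of_forall_notMem fun y hy => ?_
    have a1 := hy θ₀
    have a2 := neg_snd_mem_supportSet hp₁ hy θ₀
    have a3 := hXY θ₀
    have hc : 0 < Real.cos θ₀ := Real.cos_pos_of_mem_Ioo ⟨by linarith [Real.pi_pos], by linarith⟩
    simp only at a1 a2
    nlinarith [mul_lt_mul_of_pos_right hx hc]
  have hmeas : Measurable fun x => volume (Prod.mk x ⁻¹' supportSet p) :=
    measurable_measure_prodMk_left hS
  rw [Measure.volume_eq_prod, Measure.prod_apply hS, lintegral_eq_two_mul_of_even hmeas]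
  swap
  · intro x
    congr 1
    ext y
    exact ⟨fun h => by simpa using neg_fst_mem_supportSet hp₂ h, neg_fst_mem_supportSet hp₂⟩
  have hcut : ∫⁻ x in Ioi 0, volume (Prod.mk x ⁻¹' supportSet p)
      = ∫⁻ x in Ioo 0 (X θ₀), volume (Prod.mk x ⁻¹' supportSet p) := by
    rw [setLIntegral_congr (Ioo_ae_eq_Ioc (a := (0 : ℝ)) (b := X θ₀) (μ := volume)),
      ← lintegral_inter_add_sdiff _ (Ioi 0) (measurableSet_Iic (a := X θ₀)), Ioi_inter_Iic]
    refine (congrArg _ (setLIntegral_eq_zero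
      (measurableSet_Ioi.diff measurableSet_Iic) ?_)).trans (add_zero _)
    rintro x ⟨hx, hx'⟩
    simp [hempty x (not_le.1 hx')]
  -- Substitution `x = X θ`: the slice over `X θ` has length `2 * Y θ`, which with the evenness in
  -- `x` yields the factor 4.
  rw [hcut, ← himg, lintegral_image_eq_lintegral_deriv_mul_of_antitoneOn measurableSet_Ioo
    (fun θ _ => (hX θ).hasDerivWithinAt) (hanti.antitoneOn.mono Ioo_subset_Icc_self)]
  have hval : ∫⁻ θ in Ioo θ₀ θ₁, ENNReal.ofReal (-X' θ) * volume (Prod.mk (X θ) ⁻¹' supportSet p)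
      = ∫⁻ θ in Ioo θ₀ θ₁, ENNReal.ofReal (2 * (Y θ * (-X' θ))) := by
    refine setLIntegral_congr_fun measurableSet_Ioo fun θ h => ?_
    have hs : 0 < Real.sin θ := Real.sin_pos_of_pos_of_lt_pi (by linarith [h.1])
      (by linarith [h.2, Real.pi_pos])
    rw [supportSet_slice hp₁ hs (hXY θ) (hmem θ h), Real.volume_Icc,
      ← ENNReal.ofReal_mul (by linarith [hneg θ h])]
    congr 1
    ring
  have hint : ∫⁻ θ in Ioo θ₀ θ₁, ENNReal.ofReal (2 * (Y θ * (-X' θ)))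
      = ENNReal.ofReal (∫ θ in Ioo θ₀ θ₁, 2 * (Y θ * (-X' θ))) := by
    refine (ofReal_integral_eq_lintegral_ofReal ?_ ?_).symm
    · have : Continuous fun θ => 2 * (Y θ * (-X' θ)) := by fun_prop
      exact this.integrableOn_Icc.mono_set Ioo_subset_Icc_self
    · refine (ae_restrict_iff' measurableSet_Ioo).2 (Filter.Eventually.of_forall fun θ h => ?_)
      have := mul_nonneg (hY θ h) (neg_nonneg.2 (hneg θ h).le)
      simp only [Pi.zero_apply]
      linarith
  rw [hval, hint, ← integral_Ioc_eq_integral_Ioo, ← intervalIntegral.integral_of_le hθ.le,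
    intervalIntegral.integral_const_mul, show (2 : ENNReal) = ENNReal.ofReal 2 by simp,
    ← ENNReal.ofReal_mul (by norm_num)]
  congr 1
  ring

/-! ### Parallel curves of the ellipse and the antiderivative `F` -/

/-- The support function of the ellipse with semi-axes `a` and `b` along the axes. -/
def ellipseSupport (a b θ : ℝ) : ℝ := Real.sqrt (a ^ 2 * Real.cos θ ^ 2 + b ^ 2 * Real.sin θ ^ 2)

section
variable {a b : ℝ}

theorem ellipseSupport_radicand_pos (hb : 0 < b) (hab : b ≤ a) (θ : ℝ) :
    0 < a ^ 2 * Real.cos θ ^ 2 + b ^ 2 * Real.sin θ ^ 2 := by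
  have h1 : b ^ 2 ≤ a ^ 2 := by gcongr
  nlinarith [Real.sin_sq_add_cos_sq θ, mul_le_mul_of_nonneg_right h1 (sq_nonneg (Real.cos θ)),
    pow_pos hb 2]

theorem ellipseSupport_pos (hb : 0 < b) (hab : b ≤ a) (θ : ℝ) : 0 < ellipseSupport a b θ :=
  Real.sqrt_pos.2 (ellipseSupport_radicand_pos hb hab θ)

theorem ellipseSupport_sq (a b θ : ℝ) :
    ellipseSupport a b θ ^ 2 = a ^ 2 * Real.cos θ ^ 2 + b ^ 2 * Real.sin θ ^ 2 :=
  Real.sq_sqrt (by positivity)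

theorem ellipseSupport_neg (a b θ : ℝ) : ellipseSupport a b (-θ) = ellipseSupport a b θ := by
  simp [ellipseSupport]

theorem ellipseSupport_pi_sub (a b θ : ℝ) :
    ellipseSupport a b (Real.pi - θ) = ellipseSupport a b θ := by
  simp [ellipseSupport]

@[fun_prop]
theorem continuous_ellipseSupport (a b : ℝ) : Continuous (ellipseSupport a b) := by
  unfold ellipseSupport; fun_prop

theorem hasDerivAt_ellipseSupport (hb : 0 < b) (hab : b ≤ a) (θ : ℝ) :
    HasDerivAt (ellipseSupport a b)
      (-((a ^ 2 - b ^ 2) * Real.sin θ * Real.cos θ) / ellipseSupport a b θ) θ := by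
  have h1 := (((Real.hasDerivAt_cos θ).pow 2).const_mul (a ^ 2)).add
    (((Real.hasDerivAt_sin θ).pow 2).const_mul (b ^ 2))
  have h2 := h1.sqrt (ellipseSupport_radicand_pos hb hab θ).ne'
  have hpos := ellipseSupport_pos hb hab θ
  refine h2.congr_deriv ?_
  change _ / (2 * ellipseSupport a b θ) = _
  field_simp
  simp
  ring

/-- First coordinate of the curve parallel to the ellipse at (inner) distance `ρ`, as a function of
the normal angle. -/
def parallelX (a b ρ θ : ℝ) : ℝ := Real.cos θ * (a ^ 2 / ellipseSupport a b θ - ρ)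

/-- Second coordinate of the curve parallel to the ellipse at (inner) distance `ρ`. -/
def parallelY (a b ρ θ : ℝ) : ℝ := Real.sin θ * (b ^ 2 / ellipseSupport a b θ - ρ)

/-- The derivative of `parallelX` in the normal angle. -/
def parallelX' (a b ρ θ : ℝ) : ℝ :=
  -Real.sin θ * (a ^ 2 * b ^ 2 / ellipseSupport a b θ ^ 3 - ρ)

theorem parallel_support (hb : 0 < b) (hab : b ≤ a) (ρ θ : ℝ) :
    parallelX a b ρ θ * Real.cos θ + parallelY a b ρ θ * Real.sin θ
      = ellipseSupport a b θ - ρ := by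
  have hpos := ellipseSupport_pos hb hab θ
  have hsq := ellipseSupport_sq a b θ
  unfold parallelX parallelY
  field_simp
  linear_combination -hsq - ρ * ellipseSupport a b θ * Real.sin_sq_add_cos_sq θ

theorem hasDerivAt_parallelX (hb : 0 < b) (hab : b ≤ a) (ρ θ : ℝ) :
    HasDerivAt (parallelX a b ρ) (parallelX' a b ρ θ) θ := by
  have hpos := ellipseSupport_pos hb hab θ
  have hsq := ellipseSupport_sq a b θ
  have h1 := (Real.hasDerivAt_cos θ).mul
    (((hasDerivAt_const θ (a ^ 2)).div (hasDerivAt_ellipseSupport hb hab θ) hpos.ne').sub_const ρ)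
  refine h1.congr_deriv ?_
  unfold parallelX'
  simp only [Pi.div_apply]
  field_simp
  linear_combination (-a ^ 2 * Real.sin θ) * hsq
    - a ^ 2 * b ^ 2 * Real.sin θ * Real.sin_sq_add_cos_sq θ

theorem hasDerivAt_parallelY (hb : 0 < b) (hab : b ≤ a) (ρ θ : ℝ) :
    HasDerivAt (parallelY a b ρ)
      (Real.cos θ * (a ^ 2 * b ^ 2 / ellipseSupport a b θ ^ 3 - ρ)) θ := by
  have hpos := ellipseSupport_pos hb hab θ
  have hsq := ellipseSupport_sq a b θ
  have h1 := (Real.hasDerivAt_sin θ).mul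
    (((hasDerivAt_const θ (b ^ 2)).div (hasDerivAt_ellipseSupport hb hab θ) hpos.ne').sub_const ρ)
  refine h1.congr_deriv ?_
  simp only [Pi.div_apply]
  field_simp
  linear_combination (b ^ 2 * Real.cos θ) * hsq
    + a ^ 2 * b ^ 2 * Real.cos θ * Real.sin_sq_add_cos_sq θ

theorem continuous_parallelX' (hb : 0 < b) (hab : b ≤ a) (ρ : ℝ) :
    Continuous (parallelX' a b ρ) := by
  unfold parallelX'
  have : ∀ θ, ellipseSupport a b θ ^ 3 ≠ 0 := fun θ => (pow_pos (ellipseSupport_pos hb hab θ) 3).ne'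
  fun_prop (disch := assumption)

theorem continuous_parallelX (hb : 0 < b) (hab : b ≤ a) (ρ : ℝ) :
    Continuous (parallelX a b ρ) :=
  continuous_iff_continuousAt.2 fun θ => (hasDerivAt_parallelX hb hab ρ θ).continuousAt

theorem continuous_parallelY (hb : 0 < b) (hab : b ≤ a) (ρ : ℝ) :
    Continuous (parallelY a b ρ) :=
  continuous_iff_continuousAt.2 fun θ => (hasDerivAt_parallelY hb hab ρ θ).continuousAt

theorem eccentricity_sq (hb : 0 < b) (hab : b ≤ a) :
    eccentricity a b ^ 2 = (a ^ 2 - b ^ 2) / a ^ 2 := by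
  have h1 : b ^ 2 ≤ a ^ 2 := by gcongr
  rw [eccentricity, div_pow, Real.sq_sqrt (by linarith)]

theorem sqrt_one_sub_eccentricity (hb : 0 < b) (hab : b ≤ a) (θ : ℝ) :
    Real.sqrt (1 - eccentricity a b ^ 2 * Real.sin θ ^ 2) = ellipseSupport a b θ / a := by
  have ha : 0 < a := hb.trans_le hab
  rw [eccentricity_sq hb hab, ellipseSupport, ← Real.sqrt_sq ha.le, ← Real.sqrt_div' _ (by positivity),
    Real.sqrt_sq ha.le]
  congr 1
  field_simp
  linear_combination (-a ^ 2) * Real.sin_sq_add_cos_sq θ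

theorem areaF_eq (hb : 0 < b) (hab : b ≤ a) (ρ φ : ℝ) :
    areaF a b ρ φ = 2 * ρ ^ 2 * φ + 2 * a * b * Real.arctan (b / a * Real.tan φ)
      - 4 * ρ * (∫ θ in (0 : ℝ)..φ, ellipseSupport a b θ)
      + ρ * (a ^ 2 - b ^ 2) * Real.sin (2 * φ) / ellipseSupport a b φ := by
  have ha : 0 < a := hb.trans_le hab
  have hpos := ellipseSupport_pos hb hab φ
  simp only [areaF, ellipticE, sqrt_one_sub_eccentricity hb hab, intervalIntegral.integral_div]
  rw [eccentricity_sq hb hab]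
  field_simp

/-- Since `F' = 2 * (X * Y' - Y * X')`, the function `F` is four times the signed sector area swept
by the parallel curve. Subtracting `2 * X * Y` converts sector area into area under the curve, and
the correction vanishes at endpoints lying on an axis. -/
theorem hasDerivAt_areaF (hb : 0 < b) (hab : b ≤ a) (ρ : ℝ) {φ : ℝ} (hφ : 0 < Real.cos φ) :
    HasDerivAt (fun φ => areaF a b ρ φ - 2 * (parallelX a b ρ φ * parallelY a b ρ φ))
      (4 * (parallelY a b ρ φ * -parallelX' a b ρ φ)) φ := by
  have ha : 0 < a := hb.trans_le hab
  have hpos := ellipseSupport_pos hb hab φ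
  have hsq := ellipseSupport_sq a b φ
  have hcs := Real.sin_sq_add_cos_sq φ
  have h1 := (hasDerivAt_id φ).const_mul (2 * ρ ^ 2)
  have h2 := (((Real.hasDerivAt_tan hφ.ne').const_mul (b / a)).arctan).const_mul (2 * a * b)
  have h3 := (intervalIntegral.integral_hasDerivAt_right
    ((continuous_ellipseSupport a b).intervalIntegrable 0 φ)
    ((continuous_ellipseSupport a b).stronglyMeasurableAtFilter _ _)
    (continuous_ellipseSupport a b).continuousAt).const_mul (4 * ρ)
  have h4 := (((((hasDerivAt_id φ).const_mul 2).sin).const_mul (ρ * (a ^ 2 - b ^ 2))).div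
    (hasDerivAt_ellipseSupport hb hab φ) hpos.ne')
  have h5 := ((hasDerivAt_parallelX hb hab ρ φ).mul (hasDerivAt_parallelY hb hab ρ φ)).const_mul 2
  have h := ((((h1.add h2).sub h3).add h4).sub h5)
  have hfun : (fun φ => areaF a b ρ φ - 2 * (parallelX a b ρ φ * parallelY a b ρ φ)) =
      (fun φ => 2 * ρ ^ 2 * φ + 2 * a * b * Real.arctan (b / a * Real.tan φ)
      - 4 * ρ * (∫ θ in (0 : ℝ)..φ, ellipseSupport a b θ)
      + ρ * (a ^ 2 - b ^ 2) * Real.sin (2 * φ) / ellipseSupport a b φ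
      - 2 * (parallelX a b ρ φ * parallelY a b ρ φ)) := by
    funext φ; rw [areaF_eq hb hab]
  rw [hfun]
  refine h.congr_deriv ?_
  have harc : 2 * a * b * (1 / (1 + (b / a * Real.tan φ) ^ 2) * (b / a * (1 / Real.cos φ ^ 2)))
      = 2 * a ^ 2 * b ^ 2 / ellipseSupport a b φ ^ 2 := by
    rw [hsq, Real.tan_eq_sin_div_cos]
    have := ellipseSupport_radicand_pos hb hab φ
    field_simp
  rw [harc]
  simp only [id, Real.sin_two_mul, Real.cos_two_mul, parallelX, parallelY, parallelX']
  generalize ellipseSupport a b φ = H at *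
  generalize Real.sin φ = s at *
  generalize Real.cos φ = c at *
  field_simp
  -- The trigonometric squares are expressed through the support function, after which the claim is
  -- a polynomial identity.
  have e1 : c ^ 2 * (a ^ 2 - b ^ 2) = H ^ 2 - b ^ 2 := by linear_combination -b ^ 2 * hcs - hsq
  have e2 : s ^ 2 * (a ^ 2 - b ^ 2) = a ^ 2 - H ^ 2 := by linear_combination a ^ 2 * hcs + hsq
  linear_combination -2 * (a ^ 2 * b ^ 2 - ρ * H ^ 3) * (-hsq - ρ * H * hcs)
    + 2 * ρ * H * (2 * H ^ 2 * e1 + c ^ 2 * (a ^ 2 - b ^ 2) * e2 + (a ^ 2 - H ^ 2) * e1)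

theorem areaStar_eq (hb : 0 < b) (hab : b ≤ a) (ρ : ℝ) :
    areaStar a b ρ = Real.pi * ρ ^ 2 + Real.pi * a * b
      - 4 * ρ * ∫ θ in (0 : ℝ)..(Real.pi / 2), ellipseSupport a b θ := by
  have ha : 0 < a := hb.trans_le hab
  simp only [areaStar, completeE, ellipticE, sqrt_one_sub_eccentricity hb hab,
    intervalIntegral.integral_div]
  field_simp

/-- Only a one-sided limit is available: `arctan (b / a * tan φ)` tends to `π / 2`, whereas at `π /
2` itself `Real.tan` has the default value `0`. The other terms are continuous. -/
theorem tendsto_areaF (hb : 0 < b) (hab : b ≤ a) (ρ : ℝ) :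
    Filter.Tendsto (areaF a b ρ) (nhdsWithin (Real.pi / 2) (Iio (Real.pi / 2)))
      (nhds (areaStar a b ρ)) := by
  have ha : 0 < a := hb.trans_le hab
  have hfun : areaF a b ρ = fun φ => 2 * ρ ^ 2 * φ + 2 * a * b * Real.arctan (b / a * Real.tan φ)
      - 4 * ρ * (∫ θ in (0 : ℝ)..φ, ellipseSupport a b θ)
      + ρ * (a ^ 2 - b ^ 2) * Real.sin (2 * φ) / ellipseSupport a b φ := by
    funext φ; rw [areaF_eq hb hab]
  have hlim : areaStar a b ρ = 2 * ρ ^ 2 * (Real.pi / 2) + 2 * a * b * (Real.pi / 2)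
      - 4 * ρ * (∫ θ in (0 : ℝ)..(Real.pi / 2), ellipseSupport a b θ)
      + ρ * (a ^ 2 - b ^ 2) * Real.sin (2 * (Real.pi / 2)) / ellipseSupport a b (Real.pi / 2) := by
    rw [areaStar_eq hb hab, mul_div_cancel₀ _ (two_ne_zero' ℝ), Real.sin_pi]
    ring
  rw [hfun, hlim]
  have hatan : Filter.Tendsto (fun φ => Real.arctan (b / a * Real.tan φ))
      (nhdsWithin (Real.pi / 2) (Iio (Real.pi / 2))) (nhds (Real.pi / 2)) :=
    (Real.tendsto_arctan_atTop.mono_right nhdsWithin_le_nhds).comp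
      (Real.tendsto_tan_pi_div_two.const_mul_atTop (by positivity))
  have hint : Continuous fun φ => ∫ θ in (0 : ℝ)..φ, ellipseSupport a b θ :=
    intervalIntegral.continuous_primitive
      (fun _ _ => (continuous_ellipseSupport a b).intervalIntegrable _ _) 0
  have hne : ∀ φ, ellipseSupport a b φ ≠ 0 := fun φ => (ellipseSupport_pos hb hab φ).ne'
  have c1 : Continuous fun φ : ℝ => 2 * ρ ^ 2 * φ := by fun_prop
  have c3 : Continuous fun φ => ρ * (a ^ 2 - b ^ 2) * Real.sin (2 * φ) / ellipseSupport a b φ := by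
    fun_prop (disch := assumption)
  exact ((((c1.tendsto _).mono_left nhdsWithin_le_nhds).add (hatan.const_mul _)).sub
    (((hint.tendsto _).mono_left nhdsWithin_le_nhds).const_mul _)).add
    ((c3.tendsto _).mono_left nhdsWithin_le_nhds)

theorem continuous_areaIntegrand (hb : 0 < b) (hab : b ≤ a) (ρ : ℝ) :
    Continuous fun θ => 4 * (parallelY a b ρ θ * -parallelX' a b ρ θ) :=
  continuous_const.mul ((continuous_parallelY hb hab ρ).mul (continuous_parallelX' hb hab ρ).neg)

theorem integral_area_of_lt (hb : 0 < b) (hab : b ≤ a) (ρ : ℝ) {φ₀ φ₁ : ℝ}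
    (h₀ : 0 ≤ φ₀) (h₀₁ : φ₀ ≤ φ₁) (h₁ : φ₁ < Real.pi / 2)
    (e₀ : parallelX a b ρ φ₀ * parallelY a b ρ φ₀ = 0)
    (e₁ : parallelX a b ρ φ₁ * parallelY a b ρ φ₁ = 0) :
    4 * ∫ θ in φ₀..φ₁, parallelY a b ρ θ * -parallelX' a b ρ θ
      = areaF a b ρ φ₁ - areaF a b ρ φ₀ := by
  rw [← intervalIntegral.integral_const_mul,
    intervalIntegral.integral_eq_sub_of_hasDerivAt (fun θ h => hasDerivAt_areaF hb hab ρ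
      (Real.cos_pos_of_mem_Ioo ?_)) ((continuous_areaIntegrand hb hab ρ).intervalIntegrable _ _),
    e₀, e₁]
  · ring
  · rw [uIcc_of_le h₀₁] at h
    exact ⟨by linarith [h.1, Real.pi_pos], by linarith [h.2]⟩

theorem integral_area_to_pi_div_two (hb : 0 < b) (hab : b ≤ a) (ρ : ℝ) {φ₀ : ℝ}
    (h₀ : 0 ≤ φ₀) (h₁ : φ₀ < Real.pi / 2)
    (e₀ : parallelX a b ρ φ₀ * parallelY a b ρ φ₀ = 0) :
    4 * ∫ θ in φ₀..(Real.pi / 2), parallelY a b ρ θ * -parallelX' a b ρ θ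
      = areaStar a b ρ - areaF a b ρ φ₀ := by
  have hpi := Real.pi_pos
  have hXY : Continuous fun φ => 2 * (parallelX a b ρ φ * parallelY a b ρ φ) :=
    continuous_const.mul ((continuous_parallelX hb hab ρ).mul (continuous_parallelY hb hab ρ))
  have hend : parallelX a b ρ (Real.pi / 2) = 0 := by simp [parallelX]
  have t₀ := (hasDerivAt_areaF hb hab ρ (φ := φ₀)
    (Real.cos_pos_of_mem_Ioo ⟨by linarith, h₁⟩)).continuousAt.tendsto.mono_left
      (nhdsWithin_le_nhds (s := Ioi φ₀))
  have t₁ := (tendsto_areaF hb hab ρ).sub ((hXY.tendsto (Real.pi / 2)).mono_left nhdsWithin_le_nhds)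
  rw [← intervalIntegral.integral_const_mul,
    intervalIntegral.integral_eq_sub_of_hasDerivAt_of_tendsto h₁
      (fun θ h => hasDerivAt_areaF hb hab ρ (Real.cos_pos_of_mem_Ioo ?_))
      ((continuous_areaIntegrand hb hab ρ).intervalIntegrable _ _) t₀ t₁, e₀, hend]
  · ring
  · exact ⟨by linarith [h.1], h.2⟩

theorem areaF_zero (a b ρ : ℝ) : areaF a b ρ 0 = 0 := by simp [areaF, ellipticE]

end

/-! ### Areas of the Minkowski sum and of the two containment sets -/

section
variable {a b : ℝ}

/-- Cauchy–Schwarz for the vectors `(√(a² - b²) cos θ, b)` and `(√(a² - b²) cos η, b)`, whose norms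
are the two support values. -/
theorem le_ellipseSupport_mul (hb : 0 < b) (hab : b ≤ a) (θ η : ℝ) :
    (a ^ 2 - b ^ 2) * (Real.cos θ * Real.cos η) + b ^ 2
      ≤ ellipseSupport a b θ * ellipseSupport a b η := by
  have h1 : b ^ 2 ≤ a ^ 2 := by gcongr
  rw [ellipseSupport, ellipseSupport, ← Real.sqrt_mul (by positivity)]
  apply Real.le_sqrt_of_sq_le
  rw [Real.sin_sq θ, Real.sin_sq η]
  have := mul_nonneg (mul_nonneg (sub_nonneg.2 h1) (sq_nonneg b))
    (sq_nonneg (Real.cos θ - Real.cos η))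
  linarith

/-- The reversed Cauchy–Schwarz inequality for the form `x² - y²`, as the radicand equals `a² - (a²
- b²) sin² θ`. The squares of the two sides differ by `a² (a² - b²) (sin θ - sin η)²`. -/
theorem ellipseSupport_mul_le (hb : 0 < b) (hab : b ≤ a) (θ η : ℝ) :
    ellipseSupport a b θ * ellipseSupport a b η
      ≤ a ^ 2 - (a ^ 2 - b ^ 2) * (Real.sin θ * Real.sin η) := by
  have h1 : b ^ 2 ≤ a ^ 2 := by gcongr
  have h2 : Real.sin θ * Real.sin η ≤ 1 := by
    nlinarith [Real.sin_sq_le_one θ, Real.sin_sq_le_one η, sq_nonneg (Real.sin θ - Real.sin η)]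
  rw [ellipseSupport, ellipseSupport, ← Real.sqrt_mul (by positivity), Real.sqrt_le_iff]
  constructor
  · nlinarith [sq_nonneg b]
  · rw [Real.cos_sq', Real.cos_sq']
    have := mul_nonneg (mul_nonneg (sub_nonneg.2 h1) (sq_nonneg a))
      (sq_nonneg (Real.sin θ - Real.sin η))
    linarith

theorem inner_parallel (hb : 0 < b) (hab : b ≤ a) (ρ θ η : ℝ) :
    ellipseSupport a b θ * (parallelX a b ρ θ * Real.cos η + parallelY a b ρ θ * Real.sin η)
      = a ^ 2 * (Real.cos θ * Real.cos η) + b ^ 2 * (Real.sin θ * Real.sin η)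
        - ρ * ellipseSupport a b θ * Real.cos (θ - η) := by
  have hpos := ellipseSupport_pos hb hab θ
  rw [Real.cos_sub, parallelX, parallelY]
  field_simp
  ring

/-- After multiplication by the support value `H` at `θ`, the slack in direction `η` is at least
`(b² - ρ H) (1 - cos (θ - η))`. The hypothesis is the condition for the second coordinate to be
nonnegative when `sin θ > 0`. -/
theorem parallel_mem_supportSet (hb : 0 < b) (hab : b ≤ a) {ρ θ : ℝ}
    (h : ρ * ellipseSupport a b θ ≤ b ^ 2) :
    (parallelX a b ρ θ, parallelY a b ρ θ) ∈ supportSet fun η => ellipseSupport a b η - ρ := by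
  intro η
  have hpos := ellipseSupport_pos hb hab θ
  refine le_of_mul_le_mul_left ?_ hpos
  rw [inner_parallel hb hab, Real.cos_sub]
  have h1 := le_ellipseSupport_mul hb hab θ η
  have h2 := Real.cos_le_one (θ - η)
  rw [Real.cos_sub] at h2
  nlinarith [mul_le_mul_of_nonneg_right h (sub_nonneg.2 h2)]

/-- The same computation with the reversed inequality leaves the slack `(r H - a²) (1 - cos (θ -
η))`. -/
theorem neg_parallel_mem_supportSet (hb : 0 < b) (hab : b ≤ a) {r θ : ℝ}
    (h : a ^ 2 ≤ r * ellipseSupport a b θ) :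
    (-parallelX a b r θ, -parallelY a b r θ) ∈ supportSet fun η => r - ellipseSupport a b η := by
  intro η
  have hpos := ellipseSupport_pos hb hab θ
  refine le_of_mul_le_mul_left ?_ hpos
  have h0 := inner_parallel hb hab r θ η
  rw [Real.cos_sub] at h0
  have h1 := ellipseSupport_mul_le hb hab θ η
  have h2 := Real.cos_le_one (θ - η)
  rw [Real.cos_sub] at h2
  simp only
  nlinarith [mul_le_mul_of_nonneg_right h (sub_nonneg.2 h2)]

theorem ellipseSupport_le (hb : 0 < b) (hab : b ≤ a) (θ : ℝ) : ellipseSupport a b θ ≤ a := by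
  have ha := hb.trans_le hab
  have h1 : b ^ 2 ≤ a ^ 2 := by gcongr
  rw [ellipseSupport, Real.sqrt_le_iff]
  refine ⟨ha.le, ?_⟩
  rw [Real.cos_sq']
  nlinarith [sq_nonneg (Real.sin θ)]

theorem le_ellipseSupport (hb : 0 < b) (hab : b ≤ a) (θ : ℝ) : b ≤ ellipseSupport a b θ := by
  have h1 : b ^ 2 ≤ a ^ 2 := by gcongr
  rw [ellipseSupport]
  apply Real.le_sqrt_of_sq_le
  rw [Real.sin_sq]
  nlinarith [sq_nonneg (Real.cos θ)]

/-- The area of the region bounded by a parallel curve of the ellipse, whose part in the first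
quadrant starts at the normal angle `θ₀`. -/
theorem hasMeasure_parallel (hb : 0 < b) (hab : b ≤ a) {ρ θ₀ : ℝ} (hθ₀ : 0 ≤ θ₀)
    (hθ₁ : θ₀ < Real.pi / 2)
    (hlt : ∀ θ ∈ Ioo θ₀ (Real.pi / 2), ρ * ellipseSupport a b θ < b ^ 2)
    (h₀ : parallelY a b ρ θ₀ = 0) :
    HasMeasure volume (supportSet fun η => ellipseSupport a b η - ρ)
      (areaStar a b ρ - areaF a b ρ θ₀) := by
  rw [← integral_area_to_pi_div_two hb hab ρ hθ₀ hθ₁ (by rw [h₀, mul_zero])]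
  have hs : ∀ θ ∈ Ioo θ₀ (Real.pi / 2), 0 < Real.sin θ := fun θ h =>
    Real.sin_pos_of_pos_of_lt_pi (by linarith [h.1]) (by linarith [h.2, Real.pi_pos])
  have hY : ∀ θ ∈ Ioo θ₀ (Real.pi / 2), 0 < b ^ 2 / ellipseSupport a b θ - ρ := fun θ h => by
    rw [sub_pos, lt_div_iff₀ (ellipseSupport_pos hb hab θ)]
    exact hlt θ h
  refine hasMeasure_supportSet hθ₁ hθ₀ le_rfl (by simp [ellipseSupport_neg])
    (by simp [ellipseSupport_pi_sub]) (parallel_support hb hab ρ)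
    (hasDerivAt_parallelX hb hab ρ) (continuous_parallelX' hb hab ρ)
    (continuous_parallelY hb hab ρ) ?_ ?_ ?_ (by rw [h₀, zero_mul]) (by simp [parallelX])
  · intro θ h
    have hpos := ellipseSupport_pos hb hab θ
    rw [parallelX', neg_mul, neg_lt_zero]
    refine mul_pos (hs θ h) ?_
    -- `a² b² / H³` is the radius of curvature at normal angle `θ`. As `H ≤ a`, it is at least `b² /
    -- H > ρ`, so the parallel curve has no cusp on this arc.
    have h1 : b ^ 2 / ellipseSupport a b θ ≤ a ^ 2 * b ^ 2 / ellipseSupport a b θ ^ 3 := by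
      rw [div_le_div_iff₀ hpos (by positivity)]
      have : ellipseSupport a b θ ^ 2 ≤ a ^ 2 := by
        have := ellipseSupport_le hb hab θ
        gcongr
      nlinarith [mul_le_mul_of_nonneg_right this (by positivity : 0 ≤ b ^ 2 * ellipseSupport a b θ)]
    linarith [hY θ h]
  · exact fun θ h => (mul_pos (hs θ h) (hY θ h)).le
  · exact fun θ h => parallel_mem_supportSet hb hab (hlt θ h).le

/-- The area of the erosion of a disk by the ellipse, when its boundary in the first quadrant
ends at the normal angle `θ₁`. -/
theorem hasMeasure_erosion (hb : 0 < b) (hab : b ≤ a) {r θ₁ : ℝ} (hθ₀ : 0 < θ₁)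
    (hθ₁ : θ₁ ≤ Real.pi / 2)
    (hlt : ∀ θ ∈ Ioo 0 θ₁, a ^ 2 < r * ellipseSupport a b θ)
    (h₁ : parallelX a b r θ₁ = 0) :
    HasMeasure volume (supportSet fun η => r - ellipseSupport a b η)
      (4 * ∫ θ in (0 : ℝ)..θ₁, parallelY a b r θ * -parallelX' a b r θ) := by
  have hs : ∀ θ ∈ Ioo 0 θ₁, 0 < Real.sin θ := fun θ h =>
    Real.sin_pos_of_pos_of_lt_pi (by linarith [h.1]) (by linarith [h.2, Real.pi_pos])
  -- For the erosion the boundary is the parallel curve reflected in the origin; the two sign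
  -- changes cancel in the integrand.
  have h := hasMeasure_supportSet (p := fun η => r - ellipseSupport a b η)
    (X := fun θ => -parallelX a b r θ) (Y := fun θ => -parallelY a b r θ)
    (X' := fun θ => -parallelX' a b r θ) hθ₀ le_rfl hθ₁ (by simp [ellipseSupport_neg])
    (by simp [ellipseSupport_pi_sub])
    (fun θ => by have := parallel_support hb hab r θ; linarith)
    (fun θ => (hasDerivAt_parallelX hb hab r θ).neg) (continuous_parallelX' hb hab r).neg
    (continuous_parallelY hb hab r).neg ?_ ?_ ?_ (by simp) (by rw [h₁, neg_zero])
  · convert h using 4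
    ring
  · intro θ h
    have hpos := ellipseSupport_pos hb hab θ
    have h1 : a ^ 2 * b ^ 2 / ellipseSupport a b θ ^ 3 ≤ a ^ 2 / ellipseSupport a b θ := by
      rw [div_le_div_iff₀ (by positivity) hpos]
      have : b ^ 2 ≤ ellipseSupport a b θ ^ 2 := by
        have := le_ellipseSupport hb hab θ
        gcongr
      nlinarith [mul_le_mul_of_nonneg_right this (by positivity : 0 ≤ a ^ 2 * ellipseSupport a b θ)]
    have h2 : a ^ 2 / ellipseSupport a b θ < r := by
      rw [div_lt_iff₀ hpos]; exact hlt θ h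
    simp only [parallelX', neg_mul, neg_neg]
    exact mul_neg_of_pos_of_neg (hs θ h) (by linarith)
  · intro θ h
    have hpos := ellipseSupport_pos hb hab θ
    have h2 : b ^ 2 / ellipseSupport a b θ < r := by
      rw [div_lt_iff₀ hpos]
      exact lt_of_le_of_lt (by gcongr) (hlt θ h)
    simp only [parallelY]
    rw [neg_nonneg]
    exact (mul_neg_of_pos_of_neg (hs θ h) (by linarith)).le
  · exact fun θ h => neg_parallel_mem_supportSet hb hab (hlt θ h).le

/-- A support set is null if its vertical width is not positive. -/
theorem hasMeasure_supportSet_zero_of_vertical {p : ℝ → ℝ} (h₁ : p (Real.pi / 2) ≤ 0)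
    (h₂ : p (-(Real.pi / 2)) ≤ 0) : HasMeasure volume (supportSet p) 0 := by
  have h0 : volume (supportSet p) = 0 := by
    refine measure_mono_null (t := univ ×ˢ {0}) ?_ ?_
    · rintro ⟨x, y⟩ h
      have e1 := h (Real.pi / 2)
      have e2 := h (-(Real.pi / 2))
      simp at e1 e2
      exact ⟨mem_univ _, by simp only [mem_singleton_iff]; linarith⟩
    · rw [Measure.volume_eq_prod, Measure.prod_prod]; simp
  exact ⟨(isClosed_supportSet p).measurableSet.nullMeasurableSet, by simp [h0], by simp [h0]⟩

/-- A support set is null if its horizontal width is not positive. -/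
theorem hasMeasure_supportSet_zero_of_horizontal {p : ℝ → ℝ} (h₁ : p 0 ≤ 0)
    (h₂ : p Real.pi ≤ 0) : HasMeasure volume (supportSet p) 0 := by
  have h0 : volume (supportSet p) = 0 := by
    refine measure_mono_null (t := {0} ×ˢ univ) ?_ ?_
    · rintro ⟨x, y⟩ h
      have e1 := h 0
      have e2 := h Real.pi
      simp at e1 e2
      exact ⟨by simp only [mem_singleton_iff]; linarith, mem_univ _⟩
    · rw [Measure.volume_eq_prod, Measure.prod_prod]; simp
  exact ⟨(isClosed_supportSet p).measurableSet.nullMeasurableSet, by simp [h0], by simp [h0]⟩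

theorem ellipseSupport_sq_eq (a b θ : ℝ) :
    ellipseSupport a b θ ^ 2 = b ^ 2 + (a ^ 2 - b ^ 2) * Real.cos θ ^ 2 := by
  rw [ellipseSupport_sq, Real.sin_sq]; ring

/-- The area of the Minkowski sum of the elliptic region and a disk of radius `r`. -/
theorem hasMeasure_outer (hb : 0 < b) (hab : b ≤ a) {r : ℝ} (hr : 0 < r) :
    HasMeasure volume (supportSet fun η => ellipseSupport a b η + r) (areaStar a b (-r)) := by
  have h := hasMeasure_parallel hb hab (ρ := -r) le_rfl (by positivity)
    (fun θ _ => by nlinarith [mul_pos hr (ellipseSupport_pos hb hab θ), pow_pos hb 2])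
    (by simp [parallelY])
  simpa [areaF_zero] using h

/-- The least radius of curvature of the ellipse is `b² / a`. Up to there the whole quarter of the
inner parallel curve bounds the set. For larger `r < b` the part before the normal angle `α`,
defined by `r H = b²`, lies below the first axis and is dropped. For `r ≥ b` the vertical width is
not positive. -/
theorem hasMeasure_circleInEllipse (hb : 0 < b) (hab : b ≤ a) {r : ℝ} (hr : 0 < r) :
    HasMeasure volume (supportSet fun η => ellipseSupport a b η - r)
      (areaCircleInEllipse a b r) := by
  have ha := hb.trans_le hab
  have h1 : b ^ 2 ≤ a ^ 2 := by gcongr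
  have hpi := Real.pi_pos
  unfold areaCircleInEllipse
  split_ifs with hbr hlt
  · refine hasMeasure_supportSet_zero_of_vertical ?_ ?_ <;>
      simp [ellipseSupport, Real.sqrt_sq hb.le, hbr]
  · push Not at hbr
    rw [div_lt_iff₀ ha] at hlt
    have hb' : 0 < b ^ 2 - r ^ 2 := by nlinarith
    have hn : 0 ≤ r ^ 2 * a ^ 2 - b ^ 4 := by nlinarith [pow_pos hb 2]
    have hab' : 0 < a ^ 2 - b ^ 2 := by nlinarith
    have hcos : Real.cos (angleAlpha a b r) ^ 2
        = b ^ 2 * (b ^ 2 - r ^ 2) / (r ^ 2 * (a ^ 2 - b ^ 2)) := by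
      rw [angleAlpha, Real.cos_sq_arctan, div_pow, mul_pow, Real.sq_sqrt hn, Real.sq_sqrt hb'.le]
      have h3 : 1 + (r ^ 2 * a ^ 2 - b ^ 4) / (b ^ 2 * (b ^ 2 - r ^ 2))
        = r ^ 2 * (a ^ 2 - b ^ 2) / (b ^ 2 * (b ^ 2 - r ^ 2)) := by
        field_simp
        ring
      rw [h3, one_div_div]
    have hα0 : 0 ≤ angleAlpha a b r := Real.arctan_nonneg.2 (by positivity)
    have hα1 : angleAlpha a b r < Real.pi / 2 := Real.arctan_lt_pi_div_two _
    -- This form shows both that `r H = b²` at `α` and that `r H < b²` beyond it.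
    have hsq : ∀ θ, (r * ellipseSupport a b θ) ^ 2 = (b ^ 2) ^ 2 + r ^ 2 * (a ^ 2 - b ^ 2) *
        (Real.cos θ ^ 2 - Real.cos (angleAlpha a b r) ^ 2) := by
      intro θ
      rw [hcos, mul_pow, ellipseSupport_sq_eq]
      field_simp
      ring
    refine hasMeasure_parallel hb hab hα0 hα1 (fun θ h => ?_) ?_
    · refine lt_of_pow_lt_pow_left₀ 2 (by positivity) ?_
      rw [hsq]
      have hc := Real.cos_lt_cos_of_nonneg_of_le_pi_div_two hα0 h.2.le h.1
      have hc0 : 0 ≤ Real.cos θ :=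
        Real.cos_nonneg_of_neg_pi_div_two_le_of_le (by linarith [h.1]) h.2.le
      have : Real.cos θ ^ 2 < Real.cos (angleAlpha a b r) ^ 2 := by gcongr
      nlinarith [mul_pos (mul_pos (pow_pos hr 2) hab') (sub_pos.2 this)]
    · have hpos := ellipseSupport_pos hb hab (angleAlpha a b r)
      have : r * ellipseSupport a b (angleAlpha a b r) = b ^ 2 := by
        refine (pow_left_inj₀ (by positivity) (by positivity) two_ne_zero).1 ?_
        rw [hsq]; ring
      rw [parallelY, ← this]
      field_simp
      simp
  · push Not at hbr hlt
    rw [le_div_iff₀ ha] at hlt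
    have h := hasMeasure_parallel hb hab (ρ := r) le_rfl (by positivity)
      (fun θ h => ?_) (by simp [parallelY])
    · simpa [areaF_zero] using h
    · refine lt_of_pow_lt_pow_left₀ 2 (by positivity) ?_
      rw [mul_pow, ellipseSupport_sq_eq, Real.cos_sq']
      have hs : 0 < Real.sin θ := Real.sin_pos_of_pos_of_lt_pi h.1 (by linarith [h.2])
      have h5 : (r * a) ^ 2 ≤ (b ^ 2) ^ 2 := by gcongr
      -- At `r = b² / a` strictness comes from `sin θ > 0` if `b < a`, but for a circle it has to
      -- come from `r < b`.
      rcases h1.eq_or_lt with he | hl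
      · rw [← he]
        have : r ^ 2 < b ^ 2 := by gcongr
        nlinarith [pow_pos hb 2, pow_pos hr 2]
      · nlinarith [mul_pos (mul_pos (pow_pos hr 2) (sub_pos.2 hl)) (pow_pos hs 2)]

/-- The mirror case: the greatest radius of curvature is `a² / b`. Below it the quarter of the
boundary ends on the second axis at the normal angle `β`, defined by `r H = a²`; from it on the
whole quarter is used. For `r ≤ a` the horizontal width is not positive. -/
theorem hasMeasure_ellipseInDisk (hb : 0 < b) (hab : b ≤ a) {r : ℝ} (hr : 0 < r) :
    HasMeasure volume (supportSet fun η => r - ellipseSupport a b η)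
      (areaEllipseInDisk a b r) := by
  have ha := hb.trans_le hab
  have h1 : b ^ 2 ≤ a ^ 2 := by gcongr
  have hpi := Real.pi_pos
  unfold areaEllipseInDisk
  split_ifs with hra hlt
  · refine hasMeasure_supportSet_zero_of_horizontal ?_ ?_ <;>
      simp [ellipseSupport, Real.sqrt_sq ha.le, hra]
  · push Not at hra
    rw [lt_div_iff₀ hb] at hlt
    have hb' : 0 < r ^ 2 - a ^ 2 := by nlinarith
    have hn : 0 < a ^ 4 - r ^ 2 * b ^ 2 := by nlinarith [mul_pos hr hb]
    have hab' : 0 < a ^ 2 - b ^ 2 := by nlinarith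
    have hcos : Real.cos (angleBeta a b r) ^ 2
        = (a ^ 4 - r ^ 2 * b ^ 2) / (r ^ 2 * (a ^ 2 - b ^ 2)) := by
      rw [angleBeta, Real.cos_sq_arctan, div_pow, mul_pow, Real.sq_sqrt hn.le, Real.sq_sqrt hb'.le]
      have h3 : 1 + a ^ 2 * (r ^ 2 - a ^ 2) / (a ^ 4 - r ^ 2 * b ^ 2)
        = r ^ 2 * (a ^ 2 - b ^ 2) / (a ^ 4 - r ^ 2 * b ^ 2) := by
        field_simp
        ring
      rw [h3, one_div_div]
    have hβ0 : 0 < angleBeta a b r := Real.arctan_pos.2 (by positivity)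
    have hβ1 : angleBeta a b r < Real.pi / 2 := Real.arctan_lt_pi_div_two _
    have hsq : ∀ θ, (r * ellipseSupport a b θ) ^ 2 = (a ^ 2) ^ 2 + r ^ 2 * (a ^ 2 - b ^ 2) *
        (Real.cos θ ^ 2 - Real.cos (angleBeta a b r) ^ 2) := by
      intro θ
      rw [hcos, mul_pow, ellipseSupport_sq_eq]
      field_simp
      ring
    have hX : parallelX a b r (angleBeta a b r) = 0 := by
      have hpos := ellipseSupport_pos hb hab (angleBeta a b r)
      have : r * ellipseSupport a b (angleBeta a b r) = a ^ 2 := by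
        refine (pow_left_inj₀ (by positivity) (by positivity) two_ne_zero).1 ?_
        rw [hsq]; ring
      rw [parallelX, ← this]
      field_simp
      simp
    have h := hasMeasure_erosion hb hab hβ0 hβ1.le (fun θ h => ?_) hX
    · rwa [integral_area_of_lt hb hab r le_rfl hβ0.le hβ1 (by simp [parallelY])
        (by rw [hX, zero_mul]), areaF_zero, sub_zero] at h
    · refine lt_of_pow_lt_pow_left₀ 2 (mul_pos hr (ellipseSupport_pos hb hab θ)).le ?_
      rw [hsq]
      have hc := Real.cos_lt_cos_of_nonneg_of_le_pi_div_two h.1.le hβ1.le h.2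
      have hc0 : 0 ≤ Real.cos (angleBeta a b r) :=
        Real.cos_nonneg_of_neg_pi_div_two_le_of_le (by linarith) hβ1.le
      have : Real.cos (angleBeta a b r) ^ 2 < Real.cos θ ^ 2 := by gcongr
      nlinarith [mul_pos (mul_pos (pow_pos hr 2) hab') (sub_pos.2 this)]
  · push Not at hra hlt
    rw [div_le_iff₀ hb] at hlt
    have h := hasMeasure_erosion hb hab (r := r) (half_pos hpi) le_rfl (fun θ h => ?_)
      (by simp [parallelX])
    · rwa [integral_area_to_pi_div_two hb hab r le_rfl (half_pos hpi) (by simp [parallelY]),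
        areaF_zero, sub_zero] at h
    · refine lt_of_pow_lt_pow_left₀ 2 (mul_pos hr (ellipseSupport_pos hb hab θ)).le ?_
      rw [mul_pow, ellipseSupport_sq_eq]
      have hs : 0 < Real.cos θ := Real.cos_pos_of_mem_Ioo ⟨by linarith [h.1], h.2⟩
      have h5 : (a ^ 2) ^ 2 ≤ (r * b) ^ 2 := by gcongr
      rcases h1.eq_or_lt with he | hl
      · rw [← he]
        have : b ^ 2 < r ^ 2 := by rw [he]; gcongr
        nlinarith [pow_pos hb 2, pow_pos hr 2]
      · nlinarith [mul_pos (mul_pos (pow_pos hr 2) (sub_pos.2 hl)) (pow_pos hs 2)]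

end

/-! ### The area formula with multiplicity -/

section
variable {E : Type*} [NormedAddCommGroup E] [NormedSpace ℝ E] [FiniteDimensional ℝ E]
  [MeasurableSpace E] [BorelSpace E]

/-- **Area formula** for a `C¹` map between spaces of the same dimension: the integral of the
number of preimages in `s` is the integral over `s` of the absolute value of the Jacobian. -/
theorem exists_measurable_encard_fiber (μ : Measure E) [μ.IsAddHaarMeasure] {f : E → E}
    {f' : E → E →L[ℝ] E} (hf : ∀ x, HasStrictFDerivAt f (f' x) x) (hdet : Continuous fun x => (f' x).det)
    {s : Set E} (hs : MeasurableSet s) :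
    ∃ N : E → ENNReal, Measurable N ∧
      (∀ y ∉ f '' {x | (f' x).det = 0}, N y = ((s ∩ f ⁻¹' {y}).encard : ENNReal)) ∧
      ∫⁻ y, N y ∂μ = ∫⁻ x in s, ENNReal.ofReal |(f' x).det| ∂μ := by
  have hcompl : CompleteSpace E := FiniteDimensional.complete ℝ E
  have hfc : Continuous f := continuous_iff_continuousAt.2 fun x => (hf x).continuousAt
  -- The inverse function theorem gives injectivity near each regular point. Countably many such
  -- neighbourhoods cover the regular set by Lindelöf and are then made disjoint.
  have hU : ∀ x, ∃ U : Set E, IsOpen U ∧ InjOn f U ∧ ((f' x).det ≠ 0 → x ∈ U) := by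
    intro x
    by_cases hx : (f' x).det = 0
    · exact ⟨∅, isOpen_empty, injOn_empty _, fun h => absurd hx h⟩
    · have h1 : HasStrictFDerivAt f
          ((f' x).toContinuousLinearEquivOfDetNeZero hx : E →L[ℝ] E) x := hf x
      exact ⟨(h1.toOpenPartialHomeomorph f).source, (h1.toOpenPartialHomeomorph f).open_source,
        (h1.toOpenPartialHomeomorph f).injOn, fun _ => h1.mem_toOpenPartialHomeomorph_source⟩
  choose U hUo hUi hUm using hU
  set R : Set E := {x | (f' x).det ≠ 0} with hR
  have hRm : MeasurableSet R := (isOpen_ne_fun hdet continuous_const).measurableSet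
  obtain ⟨t, -, htc, ht⟩ := TopologicalSpace.countable_cover_nhdsWithin (f := U) (s := R)
    (fun x hx => mem_nhdsWithin_of_mem_nhds ((hUo x).mem_nhds (hUm x hx)))
  obtain ⟨g, hg⟩ := (htc.insert 0).exists_eq_range (insert_nonempty _ _)
  have hcover : R ⊆ ⋃ n, U (g n) := by
    intro x hx
    obtain ⟨y, hy, hxy⟩ := mem_iUnion₂.1 (ht hx)
    have : y ∈ range g := hg ▸ mem_insert_of_mem _ hy
    obtain ⟨n, rfl⟩ := this
    exact mem_iUnion.2 ⟨n, hxy⟩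
  set A : ℕ → Set E := fun n => s ∩ R ∩ disjointed (fun n => U (g n)) n with hA
  have hAm : ∀ n, MeasurableSet (A n) := fun n =>
    (hs.inter hRm).inter (MeasurableSet.disjointed (fun n => (hUo (g n)).measurableSet) n)
  have hAd : Pairwise (Function.onFun Disjoint A) := fun i j hij =>
    (disjoint_disjointed _ hij).mono inter_subset_right inter_subset_right
  have hAi : ∀ n, InjOn f (A n) := fun n =>
    (hUi (g n)).mono (inter_subset_right.trans (disjointed_subset _ n))
  have hAU : ⋃ n, A n = s ∩ R := by
    rw [hA, ← inter_iUnion, iUnion_disjointed]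
    exact inter_eq_left.2 (inter_subset_right.trans hcover)
  have hAf : ∀ n, ∀ x ∈ A n, HasFDerivWithinAt f (f' x) (A n) x := fun n x _ =>
    (hf x).hasFDerivAt.hasFDerivWithinAt
  have him : ∀ n, MeasurableSet (f '' A n) := fun n =>
    measurable_image_of_fderivWithin (hAm n) (hAf n) (hAi n)
  -- Each piece `A n` meets a fibre at most once, so the sum of the indicators of the images counts
  -- the regular points in the fibre. Off the critical values these are all its points.
  refine ⟨fun y => ∑' n, (f '' A n).indicator 1 y,
    Measurable.tsum fun n => measurable_one.indicator (him n), ?_, ?_⟩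
  · intro y hy
    have hm : MeasurableSet (f ⁻¹' {y}) := hfc.measurable (measurableSet_singleton y)
    have h1 : s ∩ f ⁻¹' {y} = ⋃ n, (A n ∩ f ⁻¹' {y}) := by
      rw [← iUnion_inter, hAU]
      ext x
      refine ⟨fun h => ⟨⟨h.1, fun h0 => hy ⟨x, h0, h.2⟩⟩, h.2⟩, fun h => ⟨h.1.1, h.2⟩⟩
    rw [← Measure.count_apply (hs.inter hm), h1, measure_iUnion
      (fun i j hij => (hAd hij).mono inter_subset_left inter_subset_left)
      (fun n => (hAm n).inter hm)]
    refine tsum_congr fun n => ?_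
    by_cases hyn : y ∈ f '' A n
    · rw [indicator_of_mem hyn, Pi.one_apply]
      obtain ⟨x, hx, hxy⟩ := hyn
      have : A n ∩ f ⁻¹' {y} = {x} := by
        ext z
        refine ⟨fun h => hAi n h.1 hx (h.2.trans hxy.symm), ?_⟩
        rintro rfl
        exact ⟨hx, hxy⟩
      rw [this, Measure.count_singleton]
    · have : A n ∩ f ⁻¹' {y} = ∅ :=
        eq_empty_of_forall_notMem fun x h => hyn ⟨x, h.1, h.2⟩
      rw [this, measure_empty, indicator_of_notMem hyn]
  · rw [lintegral_tsum fun n => (measurable_one.indicator (him n)).aemeasurable]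
    have h2 : ∫⁻ x in s, ENNReal.ofReal |(f' x).det| ∂μ
        = ∫⁻ x in s ∩ R, ENNReal.ofReal |(f' x).det| ∂μ := by
      rw [← lintegral_inter_add_sdiff _ s hRm]
      refine (congrArg _ (setLIntegral_eq_zero (hs.diff hRm) ?_)).trans (add_zero _)
      rintro x ⟨-, hx⟩
      simp only [hR, mem_ofPred_eq, not_not] at hx
      simp [hx]
    rw [h2, ← hAU, lintegral_iUnion hAm hAd]
    refine tsum_congr fun n => ?_
    rw [lintegral_indicator_one (him n),
      lintegral_abs_det_fderiv_eq_addHaar_image μ (hAm n) (hAf n) (hAi n)]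

end

/-! ### The Jacobian integral: Poincaré's formula -/

theorem integral_abs_cos_add (δ : ℝ) :
    ∫ s in (0 : ℝ)..(2 * Real.pi), |Real.cos (s + δ)| = 4 := by
  have hpi := Real.pi_pos
  have hper : Function.Periodic (fun s => |Real.cos s|) Real.pi := fun s => by
    simp [Real.cos_add_pi]
  have hint : ∀ u v : ℝ, IntervalIntegrable (fun s => |Real.cos s|) volume u v := fun u v =>
    (by fun_prop : Continuous fun s => |Real.cos s|).intervalIntegrable _ _
  have hhalf : ∫ s in (-(Real.pi / 2))..(-(Real.pi / 2) + Real.pi), |Real.cos s| = 2 := by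
    have : ∫ s in (-(Real.pi / 2))..(-(Real.pi / 2) + Real.pi), |Real.cos s|
        = ∫ s in (-(Real.pi / 2))..(-(Real.pi / 2) + Real.pi), Real.cos s := by
      refine intervalIntegral.integral_congr fun s hs => ?_
      rw [uIcc_of_le (by linarith)] at hs
      exact abs_of_nonneg (Real.cos_nonneg_of_neg_pi_div_two_le_of_le hs.1 (by linarith [hs.2]))
    rw [this, integral_cos, show -(Real.pi / 2) + Real.pi = Real.pi / 2 by ring]
    simp
    norm_num
  rw [intervalIntegral.integral_comp_add_right (fun s => |Real.cos s|),
    ← intervalIntegral.integral_add_adjacent_intervals (hint (0 + δ) (δ + Real.pi)) (hint _ _),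
    zero_add, hper.intervalIntegral_add_eq δ (-(Real.pi / 2)),
    show 2 * Real.pi + δ = (δ + Real.pi) + Real.pi by ring,
    hper.intervalIntegral_add_eq (δ + Real.pi) (-(Real.pi / 2)), hhalf]
  norm_num

theorem integral_abs_mul_cos_sub_mul_sin (A B : ℝ) :
    ∫ s in (0 : ℝ)..(2 * Real.pi), |A * Real.cos s - B * Real.sin s|
      = 4 * Real.sqrt (A ^ 2 + B ^ 2) := by
  set z : ℂ := ⟨A, B⟩
  have hA : A = ‖z‖ * Real.cos z.arg := (Complex.norm_mul_cos_arg z).symm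
  have hB : B = ‖z‖ * Real.sin z.arg := (Complex.norm_mul_sin_arg z).symm
  have hD : Real.sqrt (A ^ 2 + B ^ 2) = ‖z‖ := by
    rw [Complex.norm_def, Complex.normSq_mk, sq, sq]
  have : ∀ s, |A * Real.cos s - B * Real.sin s| = ‖z‖ * |Real.cos (s + z.arg)| := by
    intro s
    rw [Real.cos_add, ← abs_norm z, ← abs_mul]
    congr 1
    conv_lhs => rw [hA, hB]
    ring
  simp only [this]
  rw [intervalIntegral.integral_const_mul, integral_abs_cos_add, hD]
  ring

theorem ellipseSupport_add_pi (a b θ : ℝ) :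
    ellipseSupport a b (θ + Real.pi) = ellipseSupport a b θ := by
  simp [ellipseSupport, Real.cos_add_pi, Real.sin_add_pi]

theorem integral_ellipseSupport (a b δ : ℝ) :
    ∫ t in (0 : ℝ)..(2 * Real.pi), ellipseSupport a b (t + δ)
      = 4 * ∫ t in (0 : ℝ)..(Real.pi / 2), ellipseSupport a b t := by
  have hper : Function.Periodic (ellipseSupport a b) Real.pi := ellipseSupport_add_pi a b
  have hint : ∀ u v : ℝ, IntervalIntegrable (ellipseSupport a b) volume u v := fun u v =>
    (continuous_ellipseSupport a b).intervalIntegrable _ _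
  have hrefl : ∫ t in (Real.pi / 2)..Real.pi, ellipseSupport a b t
      = ∫ t in (0 : ℝ)..(Real.pi / 2), ellipseSupport a b t := by
    have := intervalIntegral.integral_comp_sub_left (ellipseSupport a b) Real.pi
      (a := 0) (b := Real.pi / 2)
    simp only [ellipseSupport_pi_sub, sub_zero] at this
    rw [this]
    congr 1
    ring
  have hhalf : ∫ t in (0 : ℝ)..(0 + Real.pi), ellipseSupport a b t
      = 2 * ∫ t in (0 : ℝ)..(Real.pi / 2), ellipseSupport a b t := by
    rw [zero_add, ← intervalIntegral.integral_add_adjacent_intervals (hint 0 (Real.pi / 2))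
      (hint _ _), hrefl]
    ring
  rw [intervalIntegral.integral_comp_add_right (ellipseSupport a b),
    ← intervalIntegral.integral_add_adjacent_intervals (hint (0 + δ) (δ + Real.pi)) (hint _ _),
    zero_add, hper.intervalIntegral_add_eq δ 0,
    show 2 * Real.pi + δ = (δ + Real.pi) + Real.pi by ring,
    hper.intervalIntegral_add_eq (δ + Real.pi) 0, hhalf]
  ring

/-- The centre of the ellipse in direction `0` whose point with parameter `p.1` is the point with
angle `p.2` of the circle of radius `r` about the origin. -/
def contactMap (a b r : ℝ) (p : ℝ × ℝ) : ℝ × ℝ :=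
  (r * Real.cos p.2 - a * Real.cos p.1, r * Real.sin p.2 - b * Real.sin p.1)

/-- The derivative of `contactMap`. -/
def contactMapDeriv (a b r : ℝ) (p : ℝ × ℝ) : ℝ × ℝ →L[ℝ] ℝ × ℝ :=
  (Matrix.toLin (.finTwoProd ℝ) (.finTwoProd ℝ)
    !![a * Real.sin p.1, -(r * Real.sin p.2);
      -(b * Real.cos p.1), r * Real.cos p.2]).toContinuousLinearMap

theorem det_contactMapDeriv (a b r : ℝ) (p : ℝ × ℝ) :
    (contactMapDeriv a b r p).det
      = r * (a * Real.sin p.1 * Real.cos p.2 - b * Real.cos p.1 * Real.sin p.2) := by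
  rw [contactMapDeriv, LinearMap.det_toContinuousLinearMap, LinearMap.det_toLin,
    Matrix.det_fin_two_of]
  ring

theorem hasStrictFDerivAt_contactMap (a b r : ℝ) (p : ℝ × ℝ) :
    HasStrictFDerivAt (contactMap a b r) (contactMapDeriv a b r p) p := by
  have hc1 := (Real.hasStrictDerivAt_cos p.1).comp_hasStrictFDerivAt p
    (hasStrictFDerivAt_fst (𝕜 := ℝ) (E := ℝ) (F := ℝ))
  have hs1 := (Real.hasStrictDerivAt_sin p.1).comp_hasStrictFDerivAt p
    (hasStrictFDerivAt_fst (𝕜 := ℝ) (E := ℝ) (F := ℝ))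
  have hc2 := (Real.hasStrictDerivAt_cos p.2).comp_hasStrictFDerivAt p
    (hasStrictFDerivAt_snd (𝕜 := ℝ) (E := ℝ) (F := ℝ))
  have hs2 := (Real.hasStrictDerivAt_sin p.2).comp_hasStrictFDerivAt p
    (hasStrictFDerivAt_snd (𝕜 := ℝ) (E := ℝ) (F := ℝ))
  have h := ((hc2.const_mul r).sub (hc1.const_mul a)).prodMk
    ((hs2.const_mul r).sub (hs1.const_mul b))
  refine h.congr_fderiv ?_
  unfold contactMapDeriv
  rw [Matrix.toLin_finTwoProd_toContinuousLinearMap]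
  ext <;> simp

theorem continuous_det_contactMapDeriv (a b r : ℝ) :
    Continuous fun p => (contactMapDeriv a b r p).det := by
  simp only [det_contactMapDeriv]
  fun_prop

/-- Integrating over the angle on the circle leaves `4 r` times the speed of the ellipse at
parameter `t`. This speed is the support function at `t + π / 2`, so the total is `4 r` times the
perimeter. -/
theorem lintegral_abs_det_contactMapDeriv {a b r : ℝ} (hb : 0 < b) (hab : b ≤ a) (hr : 0 < r) :
    ∫⁻ p in Ico 0 (2 * Real.pi) ×ˢ Ico 0 (2 * Real.pi),
        ENNReal.ofReal |(contactMapDeriv a b r p).det|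
      = ENNReal.ofReal (16 * r * ∫ t in (0 : ℝ)..(Real.pi / 2), ellipseSupport a b t) := by
  have hpi := Real.pi_pos
  have key : ∀ f : ℝ → ℝ, Continuous f → (∀ t, 0 ≤ f t) →
      ∫⁻ t in Ico 0 (2 * Real.pi), ENNReal.ofReal (f t)
        = ENNReal.ofReal (∫ t in (0 : ℝ)..(2 * Real.pi), f t) := by
    intro f hf h0
    rw [intervalIntegral.integral_of_le (by positivity), restrict_Ico_eq_restrict_Ioc]
    exact (ofReal_integral_eq_lintegral_ofReal
      (hf.integrableOn_Icc.mono_set Ioc_subset_Icc_self)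
      (Filter.Eventually.of_forall h0)).symm
  rw [Measure.volume_eq_prod, ← Measure.prod_restrict, lintegral_prod]
  · have inner : ∀ t : ℝ, ∫⁻ s in Ico 0 (2 * Real.pi),
        ENNReal.ofReal |(contactMapDeriv a b r (t, s)).det|
        = ENNReal.ofReal (4 * r * ellipseSupport a b (t + Real.pi / 2)) := by
      intro t
      simp only [det_contactMapDeriv]
      rw [key _ (by fun_prop) (fun _ => abs_nonneg _)]
      simp only [abs_mul]
      rw [intervalIntegral.integral_const_mul, integral_abs_mul_cos_sub_mul_sin, ellipseSupport,
        Real.cos_add_pi_div_two, Real.sin_add_pi_div_two, abs_of_pos hr]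
      congr 1
      rw [neg_sq, mul_pow, mul_pow]
      ring
    simp only [inner]
    rw [key (fun t => 4 * r * ellipseSupport a b (t + Real.pi / 2)) (by fun_prop)
      (fun t => mul_nonneg (by positivity) (ellipseSupport_pos hb hab _).le),
      intervalIntegral.integral_const_mul, integral_ellipseSupport]
    congr 1
    ring
  · exact (ENNReal.continuous_ofReal.comp
      (continuous_det_contactMapDeriv a b r).abs).aemeasurable

/-! ### Parity of the number of simple zeros -/

theorem mul_pos_of_forall_ne_zero {f : ℝ → ℝ} (hf : Continuous f) {u v : ℝ} (huv : u ≤ v)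
    (h : ∀ t ∈ Icc u v, f t ≠ 0) : 0 < f u * f v := by
  by_contra hcon
  have h0 : (0 : ℝ) ∈ uIcc (f u) (f v) := by
    rw [mem_uIcc]
    rcases mul_nonpos_iff.1 (not_lt.1 hcon) with h | h
    · exact Or.inr ⟨h.2, h.1⟩
    · exact Or.inl ⟨h.1, h.2⟩
  obtain ⟨t, ht, ht0⟩ := intermediate_value_uIcc (hf.continuousOn (s := uIcc u v)) h0
  rw [uIcc_of_le huv] at ht
  exact h t ht ht0

/-- A function changes sign at a simple zero. -/
theorem exists_sign_change {f : ℝ → ℝ} {z : ℝ} (hz : f z = 0) (hd : deriv f z ≠ 0) {u v : ℝ}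
    (hu : u < z) (hv : z < v) : ∃ m ∈ Ioo u z, ∃ m' ∈ Ioo z v, f m * f m' < 0 := by
  have main : ∀ g : ℝ → ℝ, g z = 0 → 0 < deriv g z →
      ∃ m ∈ Ioo u z, ∃ m' ∈ Ioo z v, g m * g m' < 0 := by
    intro g hgz hgd
    have h := eventually_nhdsWithin_sign_eq_of_deriv_pos hgd hgz
    obtain ⟨m, hm, hms⟩ := ((h.filter_mono nhdsWithin_le_nhds).and
      (Ioo_mem_nhdsLT hu)).exists
    obtain ⟨m', hm', hms'⟩ := ((h.filter_mono nhdsWithin_le_nhds).and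
      (Ioo_mem_nhdsGT hv)).exists
    refine ⟨m, hms, m', hms', mul_neg_of_neg_of_pos ?_ ?_⟩
    · rw [← sign_eq_neg_one_iff, hm, sign_eq_neg_one_iff]
      linarith [hms.2]
    · rw [← sign_eq_one_iff, hm', sign_eq_one_iff]
      linarith [hms'.1]
  rcases hd.lt_or_gt with h | h
  · obtain ⟨m, hm, m', hm', h⟩ := main (-f) (by simp [hz]) (by rw [deriv.neg]; linarith)
    exact ⟨m, hm, m', hm', by simpa using h⟩
  · exact main f hz h

/-- A continuous function with finitely many zeros in an interval, all of them simple, has values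
of the same sign at the end points if and only if the number of zeros is even. -/
theorem mul_pos_iff_even_card_zeros {f : ℝ → ℝ} (hf : Continuous f) {u : ℝ} (hu : f u ≠ 0)
    (n : ℕ) : ∀ {v : ℝ}, u < v → f v ≠ 0 → ∀ Z : Finset ℝ, Z.card = n →
      (∀ t, t ∈ Z ↔ t ∈ Ioo u v ∧ f t = 0) → (∀ t ∈ Z, deriv f t ≠ 0) →
      (0 < f u * f v ↔ Even n) := by
  induction n with
  | zero =>
    intro v huv hv Z hZ hz _
    rw [Finset.card_eq_zero] at hZ
    subst hZ
    simp only [Even.zero, iff_true]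
    refine mul_pos_of_forall_ne_zero hf huv.le fun t ht h0 => ?_
    rcases ht.1.eq_or_lt with rfl | h1
    · exact hu h0
    rcases ht.2.eq_or_lt with rfl | h2
    · exact hv h0
    exact absurd ((hz t).2 ⟨⟨h1, h2⟩, h0⟩) (Finset.notMem_empty t)
  | succ n ih =>
    intro v huv hv Z hZ hz hd
    have hne : Z.Nonempty := Finset.card_pos.1 (by omega)
    set z := Z.max' hne with hzdef
    have hzZ : z ∈ Z := Z.max'_mem hne
    obtain ⟨⟨hz1, hz2⟩, hz0⟩ := (hz z).1 hzZ
    -- The largest zero `z` is split off: `w` lies below `z` and bounds the remaining zeros, so `m`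
    -- can be chosen between them and `z`, and the sign changes once more from `m` to `v`.
    obtain ⟨w, hw1, hw2, hw⟩ : ∃ w, u ≤ w ∧ w < z ∧ ∀ t ∈ Z.erase z, t ≤ w := by
      rcases (Z.erase z).eq_empty_or_nonempty with he | he
      · exact ⟨u, le_rfl, hz1, by simp [he]⟩
      · have hm := (Z.erase z).max'_mem he
        rw [Finset.mem_erase] at hm
        exact ⟨_, ((hz _).1 hm.2).1.1.le, lt_of_le_of_ne (Z.le_max' _ hm.2) hm.1,
          fun t ht => Finset.le_max' _ t ht⟩
    obtain ⟨m, hm, m', hm', hneg⟩ := exists_sign_change hz0 (hd z hzZ) hw2 hz2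
    have hfm : f m ≠ 0 := fun h => by simp [h] at hneg
    have hcard : (Z.erase z).card = n := by rw [Finset.card_erase_of_mem hzZ, hZ]; rfl
    have h1 := ih (hw1.trans_lt hm.1) hfm (Z.erase z) hcard (fun t => ?_)
      (fun t ht => hd t (Finset.mem_of_mem_erase ht))
    · have h2 : 0 < f m' * f v := by
        refine mul_pos_of_forall_ne_zero hf hm'.2.le fun t ht h0 => ?_
        rcases ht.2.eq_or_lt with rfl | h3
        · exact hv h0
        have : t ≤ z := Z.le_max' t ((hz t).2 ⟨⟨by linarith [ht.1, hm'.1], h3⟩, h0⟩)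
        linarith [ht.1, hm'.1]
      rw [Nat.even_add_one, ← h1]
      have h4 : f u * f m ≠ 0 := mul_ne_zero hu hfm
      have key : (f u * f v) * (f m * f m') ^ 2 = (f u * f m) * ((f m * f m') * (f m' * f v)) := by
        ring
      have h5 : (f m * f m') * (f m' * f v) < 0 := mul_neg_of_neg_of_pos hneg h2
      rw [← mul_pos_iff_of_pos_right (pow_pos (abs_pos.2 hneg.ne) 2), sq_abs, key, not_lt]
      exact ⟨fun h => (neg_of_mul_pos_left h h5.le).le,
        fun h => mul_pos_of_neg_of_neg (lt_of_le_of_ne h h4) h5⟩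
    · rw [Finset.mem_erase, hz]
      constructor
      · rintro ⟨ht1, ht2, ht3⟩
        exact ⟨⟨ht2.1, (hw t (Finset.mem_erase.2 ⟨ht1, (hz t).2 ⟨ht2, ht3⟩⟩)).trans_lt hm.1⟩, ht3⟩
      · rintro ⟨ht1, ht2⟩
        exact ⟨(ht1.2.trans hm.2).ne, ⟨ht1.1, by linarith [ht1.2, hm.2]⟩, ht2⟩

/-- A continuous periodic function has an even number of zeros in a period if they are finitely
many and simple. -/
theorem even_ncard_zeros_of_periodic {f : ℝ → ℝ} (hf : Continuous f) {T : ℝ} (hT : 0 < T)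
    (hper : Function.Periodic f T) (hfin : {t ∈ Ico 0 T | f t = 0}.Finite)
    (hd : ∀ t, f t = 0 → deriv f t ≠ 0) : Even {t ∈ Ico 0 T | f t = 0}.ncard := by
  set Z := hfin.toFinset with hZ
  -- With `m` beyond all zeros in `[0, T)`, the interval `(m - T, m)` contains exactly those zeros,
  -- and `f` agrees at its two ends.
  obtain ⟨m, hm0, hmT, hm⟩ : ∃ m, 0 ≤ m ∧ m < T ∧ ∀ t ∈ Z, t < m := by
    rcases Z.eq_empty_or_nonempty with he | he
    · exact ⟨0, le_rfl, hT, by simp [he]⟩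
    · have h1 : Z.max' he ∈ {t ∈ Ico 0 T | f t = 0} := hfin.mem_toFinset.1 (Z.max'_mem he)
      refine ⟨(Z.max' he + T) / 2, by linarith [h1.1.1], by linarith [h1.1.2], fun t ht => ?_⟩
      linarith [Z.le_max' t ht, h1.1.2]
  have hmem : ∀ t, t ∈ Z ↔ t ∈ Ico 0 T ∧ f t = 0 := fun t => hfin.mem_toFinset
  have hfm : f m ≠ 0 := fun h => lt_irrefl m (hm m ((hmem m).2 ⟨⟨hm0, hmT⟩, h⟩))
  have hfm' : f (m - T) = f m := hper.sub_eq m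
  rw [ncard_eq_toFinset_card _ hfin]
  refine (mul_pos_iff_even_card_zeros hf (u := m - T) (by rwa [hfm']) _ (by linarith) hfm Z rfl
    (fun t => ?_) fun t ht => hd t ((hmem t).1 ht).2).1 (by rw [hfm']; exact mul_self_pos.2 hfm)
  constructor
  · intro ht
    have h1 := (hmem t).1 ht
    exact ⟨⟨by linarith [h1.1.1], hm t ht⟩, h1.2⟩
  · rintro ⟨ht1, ht2⟩
    refine (hmem t).2 ⟨⟨?_, ht1.2.trans hmT⟩, ht2⟩
    by_contra hneg
    have h1 : t + T ∈ Z := (hmem _).2 ⟨⟨by linarith [ht1.1], by linarith⟩, by rw [hper t, ht2]⟩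
    linarith [hm _ h1, ht1.1]

/-! ### The contact equation, tangency and the bound of four -/

/-- The equation of the circle of radius `r` about the origin, restricted to the ellipse in
direction `0` with centre `w`. -/
def contactFun (a b r : ℝ) (w : ℝ × ℝ) (t : ℝ) : ℝ :=
  (w.1 + a * Real.cos t) ^ 2 + (w.2 + b * Real.sin t) ^ 2 - r ^ 2

@[fun_prop]
theorem continuous_contactFun (a b r : ℝ) (w : ℝ × ℝ) : Continuous (contactFun a b r w) := by
  unfold contactFun; fun_prop

theorem contactFun_periodic (a b r : ℝ) (w : ℝ × ℝ) :
    Function.Periodic (contactFun a b r w) (2 * Real.pi) := fun t => by simp [contactFun]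

theorem deriv_contactFun (a b r : ℝ) (w : ℝ × ℝ) (t : ℝ) :
    deriv (contactFun a b r w) t = 2 * ((w.2 + b * Real.sin t) * (b * Real.cos t)
      - (w.1 + a * Real.cos t) * (a * Real.sin t)) := by
  have h := (((((Real.hasDerivAt_cos t).const_mul a).const_add w.1).pow 2).add
    ((((Real.hasDerivAt_sin t).const_mul b).const_add w.2).pow 2)).sub_const (r ^ 2)
  refine (h.congr_deriv ?_).deriv
  simp
  ring

theorem exists_angle {r x y : ℝ} (hr : 0 < r) (h : x ^ 2 + y ^ 2 = r ^ 2) :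
    ∃ s ∈ Ico 0 (2 * Real.pi), x = r * Real.cos s ∧ y = r * Real.sin s := by
  set z : ℂ := ⟨x, y⟩
  have hz : ‖z‖ = r := by
    rw [Complex.norm_def, Complex.normSq_mk, ← sq, ← sq, h, Real.sqrt_sq hr.le]
  refine ⟨toIcoMod Real.two_pi_pos 0 z.arg, by simpa using toIcoMod_mem_Ico Real.two_pi_pos 0 z.arg,
    ?_, ?_⟩
  · rw [toIcoMod, zsmul_eq_mul, Real.cos_sub_int_mul_two_pi, ← hz, Complex.norm_mul_cos_arg]
  · rw [toIcoMod, zsmul_eq_mul, Real.sin_sub_int_mul_two_pi, ← hz, Complex.norm_mul_sin_arg]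

theorem contactFun_contactMap (a b r : ℝ) (p : ℝ × ℝ) :
    contactFun a b r (contactMap a b r p) p.1 = 0 := by
  simp only [contactFun, contactMap]
  linear_combination r ^ 2 * Real.sin_sq_add_cos_sq p.2

theorem exists_contactMap_eq {a b r : ℝ} (hr : 0 < r) {w : ℝ × ℝ} {t : ℝ}
    (h : contactFun a b r w t = 0) : ∃ s ∈ Ico 0 (2 * Real.pi), contactMap a b r (t, s) = w := by
  obtain ⟨s, hs, h1, h2⟩ := exists_angle hr (sub_eq_zero.1 h)
  refine ⟨s, hs, ?_⟩
  ext <;> simp only [contactMap] <;> linarith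

theorem injOn_angle {s s' : ℝ} (hs : s ∈ Ico 0 (2 * Real.pi)) (hs' : s' ∈ Ico 0 (2 * Real.pi))
    (h1 : Real.cos s = Real.cos s') (h2 : Real.sin s = Real.sin s') : s = s' := by
  obtain ⟨k, hk⟩ := Real.Angle.angle_eq_iff_two_pi_dvd_sub.1 (Real.Angle.cos_sin_inj h1 h2)
  have hpi := Real.pi_pos
  have h3 : (-1 : ℝ) < k := by
    by_contra hc
    nlinarith [hs.1, hs'.2, not_lt.1 hc]
  have h4 : (k : ℝ) < 1 := by
    by_contra hc
    nlinarith [hs.2, hs'.1, not_lt.1 hc]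
  have h5 : k = 0 := by
    have : (-1 : ℤ) < k := by exact_mod_cast h3
    have : k < (1 : ℤ) := by exact_mod_cast h4
    omega
  rw [h5] at hk
  simp at hk
  linarith

/-- For a given centre the parameter on the ellipse determines the common point, hence the angle on
the circle, so the first projection is injective on the fibre. -/
theorem encard_contactMap_fiber {a b r : ℝ} (hr : 0 < r) (w : ℝ × ℝ) :
    ((Ico 0 (2 * Real.pi) ×ˢ Ico 0 (2 * Real.pi)) ∩ contactMap a b r ⁻¹' {w}).encard
      = {t ∈ Ico 0 (2 * Real.pi) | contactFun a b r w t = 0}.encard := by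
  have himg : {t ∈ Ico 0 (2 * Real.pi) | contactFun a b r w t = 0}
      = Prod.fst '' ((Ico 0 (2 * Real.pi) ×ˢ Ico 0 (2 * Real.pi)) ∩ contactMap a b r ⁻¹' {w}) := by
    ext t
    constructor
    · rintro ⟨ht, h⟩
      obtain ⟨s, hs, hw⟩ := exists_contactMap_eq hr h
      exact ⟨(t, s), ⟨⟨ht, hs⟩, hw⟩, rfl⟩
    · rintro ⟨p, ⟨hp, hw⟩, rfl⟩
      rw [mem_preimage, mem_singleton_iff] at hw
      exact ⟨hp.1, by rw [← hw]; exact contactFun_contactMap a b r p⟩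
  rw [himg, InjOn.encard_image]
  rintro ⟨t, s⟩ ⟨hp, hw⟩ ⟨t', s'⟩ ⟨hp', hw'⟩ htt
  obtain rfl : t = t' := htt
  have h := hw.trans hw'.symm
  simp only [contactMap, Prod.mk.injEq, sub_left_inj] at h
  exact Prod.ext rfl
    (injOn_angle hp.2 hp'.2 (mul_left_cancel₀ hr.ne' h.1) (mul_left_cancel₀ hr.ne' h.2))

/-- This links the two sides: critical points of `contactMap` are exactly the multiple zeros of the
contact equation. -/
theorem deriv_contactFun_contactMap (a b r : ℝ) (p : ℝ × ℝ) :
    deriv (contactFun a b r (contactMap a b r p)) p.1 = -2 * (contactMapDeriv a b r p).det := by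
  rw [deriv_contactFun, det_contactMapDeriv]
  simp only [contactMap]
  ring

/-- The centres of the ellipses in direction `0` that touch the circle of radius `r` about the
origin. -/
def tangencySet (a b r : ℝ) : Set (ℝ × ℝ) :=
  contactMap a b r '' {p | (contactMapDeriv a b r p).det = 0}

theorem mem_tangencySet {a b r : ℝ} (hr : 0 < r) {w : ℝ × ℝ} {t : ℝ}
    (h : contactFun a b r w t = 0) (h' : deriv (contactFun a b r w) t = 0) :
    w ∈ tangencySet a b r := by
  obtain ⟨s, -, rfl⟩ := exists_contactMap_eq hr h
  rw [deriv_contactFun_contactMap a b r (t, s)] at h'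
  exact ⟨(t, s), by simpa using h', rfl⟩

/-- The equidimensional case of Sard's theorem. -/
theorem volume_tangencySet (a b r : ℝ) : volume (tangencySet a b r) = 0 :=
  addHaar_image_eq_zero_of_det_fderivWithin_eq_zero volume
    (fun p _ => (hasStrictFDerivAt_contactMap a b r p).hasFDerivAt.hasFDerivWithinAt)
    fun _ hp => hp

open Polynomial in
/-- The polynomial that becomes `4 z ^ 2 * contactFun a b r w t` at `z = exp (t * I)`. -/
def contactPoly (a b r : ℝ) (w : ℝ × ℝ) : ℂ[X] :=
  C ((a : ℂ) ^ 2) * (X ^ 2 + 1) ^ 2 - C ((b : ℂ) ^ 2) * (X ^ 2 - 1) ^ 2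
    + C (4 * a * w.1 : ℂ) * (X ^ 3 + X) - C (4 * b * w.2 * Complex.I : ℂ) * (X ^ 3 - X)
    + C (4 * (w.1 ^ 2 + w.2 ^ 2 - r ^ 2) : ℂ) * X ^ 2

theorem natDegree_contactPoly (a b r : ℝ) (w : ℝ × ℝ) : (contactPoly a b r w).natDegree ≤ 4 := by
  unfold contactPoly
  compute_degree

theorem eval_contactPoly (a b r : ℝ) (w : ℝ × ℝ) (t : ℝ) :
    (contactPoly a b r w).eval (Complex.exp (t * Complex.I))
      = 4 * Complex.exp (t * Complex.I) ^ 2 * (contactFun a b r w t : ℝ) := by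
  simp only [contactPoly, contactFun, Polynomial.eval_add, Polynomial.eval_sub, Polynomial.eval_mul,
    Polynomial.eval_C, Polynomial.eval_pow, Polynomial.eval_X, Polynomial.eval_one]
  push_cast
  rw [Complex.exp_mul_I]
  have h := Complex.sin_sq_add_cos_sq t
  have hI := Complex.I_sq
  generalize Complex.cos t = c at *
  generalize Complex.sin t = s at *
  -- Euler's formulas `cos t = (z² + 1) / (2 z)` and `sin t = (z² - 1) / (2 i z)`, cleared of
  -- denominators.
  have e1 : (c + s * Complex.I) ^ 2 + 1 = 2 * c * (c + s * Complex.I) := by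
    linear_combination -h + s ^ 2 * hI
  have e2 : (c + s * Complex.I) ^ 2 - 1 = 2 * s * Complex.I * (c + s * Complex.I) := by
    linear_combination h - s ^ 2 * hI
  generalize c + s * Complex.I = z at *
  rw [show z ^ 3 + z = z * (z ^ 2 + 1) by ring, show z ^ 3 - z = z * (z ^ 2 - 1) by ring, e1, e2]
  linear_combination (-4 * b ^ 2 * s ^ 2 * z ^ 2 - 8 * b * w.2 * s * z ^ 2) * hI

/-- Zeros in one period inject, by `t ↦ exp (t * I)`, into the roots of a polynomial of degree at
most 4. It is not the zero polynomial, since coinciding curves would be tangent at `t = 0`. -/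
theorem finite_zeros_contactFun {a b r : ℝ} (hr : 0 < r) {w : ℝ × ℝ}
    (hw : w ∉ tangencySet a b r) :
    {t ∈ Ico 0 (2 * Real.pi) | contactFun a b r w t = 0}.Finite ∧
      {t ∈ Ico 0 (2 * Real.pi) | contactFun a b r w t = 0}.ncard ≤ 4 := by
  set P := contactPoly a b r w with hP
  have hP0 : P ≠ 0 := by
    intro h0
    have hz : contactFun a b r w = fun _ => 0 := by
      funext t
      have h1 := eval_contactPoly a b r w t
      rw [← hP, h0, Polynomial.eval_zero] at h1
      have h2 := mul_eq_zero.1 h1.symm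
      rcases h2 with h2 | h2
      · exact absurd h2 (by simp [Complex.exp_ne_zero])
      · exact_mod_cast h2
    exact hw (mem_tangencySet hr (t := 0) (by rw [hz]) (by rw [hz]; simp))
  have hmaps : MapsTo (fun t : ℝ => Complex.exp (t * Complex.I))
      {t ∈ Ico 0 (2 * Real.pi) | contactFun a b r w t = 0} (P.roots.toFinset : Set ℂ) := by
    rintro t ⟨-, ht⟩
    simp only [Finset.mem_coe, Multiset.mem_toFinset]
    rw [Polynomial.mem_roots hP0, Polynomial.IsRoot.def, hP, eval_contactPoly, ht]
    simp
  have hinj : InjOn (fun t : ℝ => Complex.exp (t * Complex.I))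
      {t ∈ Ico 0 (2 * Real.pi) | contactFun a b r w t = 0} := by
    rintro t ⟨ht, -⟩ t' ⟨ht', -⟩ h
    refine injOn_angle ht ht' ?_ ?_
    · simpa [Complex.exp_ofReal_mul_I_re] using congrArg Complex.re h
    · simpa [Complex.exp_ofReal_mul_I_im] using congrArg Complex.im h
  refine ⟨Finite.of_injOn hmaps hinj (Finset.finite_toSet _), ?_⟩
  refine (ncard_le_ncard_of_injOn _ hmaps hinj (Finset.finite_toSet _)).trans ?_
  rw [ncard_coe_finset]
  exact (Multiset.toFinset_card_le _).trans ((Polynomial.card_roots' P).trans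
    (natDegree_contactPoly a b r w))

/-- An ellipse that does not touch the circle meets it in no, two or four points. -/
theorem ncard_zeros_contactFun {a b r : ℝ} (hr : 0 < r) {w : ℝ × ℝ}
    (hw : w ∉ tangencySet a b r) :
    {t ∈ Ico 0 (2 * Real.pi) | contactFun a b r w t = 0}.ncard ∈ ({0, 2, 4} : Set ℕ) := by
  obtain ⟨hfin, hle⟩ := finite_zeros_contactFun hr hw
  have hev := even_ncard_zeros_of_periodic (continuous_contactFun a b r w) Real.two_pi_pos
    (contactFun_periodic a b r w) hfin fun t ht ht' => hw (mem_tangencySet hr ht ht')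
  generalize {t ∈ Ico 0 (2 * Real.pi) | contactFun a b r w t = 0}.ncard = n at *
  interval_cases n <;> simp_all +decide

/-! ### Meeting, containment and disjointness in terms of support sets -/

section
variable {a b r : ℝ}

/-- The closed region bounded by the ellipse in direction `0` with centre `w`, in real
coordinates. -/
def ellipticDisk (a b : ℝ) (w : ℝ × ℝ) : Set (ℝ × ℝ) :=
  {v | ((v.1 - w.1) / a) ^ 2 + ((v.2 - w.2) / b) ^ 2 ≤ 1}

theorem isClosed_ellipticDisk (a b : ℝ) (w : ℝ × ℝ) : IsClosed (ellipticDisk a b w) :=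
  isClosed_le (by fun_prop) continuous_const

theorem convex_ellipticDisk (a b : ℝ) (w : ℝ × ℝ) : Convex ℝ (ellipticDisk a b w) := by
  intro p hp q hq α β hα hβ h
  simp only [ellipticDisk, mem_ofPred_eq, Prod.fst_add, Prod.snd_add, Prod.smul_fst, Prod.smul_snd,
    smul_eq_mul] at *
  have hβ' : β = 1 - α := by linarith
  subst hβ'
  have e1 : (α * p.1 + (1 - α) * q.1 - w.1) / a
      = α * ((p.1 - w.1) / a) + (1 - α) * ((q.1 - w.1) / a) := by ring
  have e2 : (α * p.2 + (1 - α) * q.2 - w.2) / b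
      = α * ((p.2 - w.2) / b) + (1 - α) * ((q.2 - w.2) / b) := by ring
  rw [e1, e2]
  nlinarith [mul_le_mul_of_nonneg_left hp hα, mul_le_mul_of_nonneg_left hq hβ,
    mul_nonneg (mul_nonneg hα hβ) (sq_nonneg ((p.1 - w.1) / a - (q.1 - w.1) / a)),
    mul_nonneg (mul_nonneg hα hβ) (sq_nonneg ((p.2 - w.2) / b - (q.2 - w.2) / b))]

theorem mem_disk (hr : 0 < r) {v : ℝ × ℝ} :
    v ∈ ellipticDisk r r 0 ↔ v.1 ^ 2 + v.2 ^ 2 ≤ r ^ 2 := by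
  simp only [ellipticDisk, mem_ofPred_eq, Prod.fst_zero, Prod.snd_zero, sub_zero, div_pow]
  rw [← add_div, div_le_one (by positivity)]

theorem isCompact_disk (hr : 0 < r) : IsCompact (ellipticDisk r r 0) := by
  refine (isCompact_Icc (a := (-r, -r)) (b := (r, r))).of_isClosed_subset
    (isClosed_ellipticDisk _ _ _) fun v hv => ?_
  rw [mem_disk hr] at hv
  have h1 := abs_le_of_sq_le_sq' (show v.1 ^ 2 ≤ r ^ 2 by nlinarith [sq_nonneg v.2]) hr.le
  have h2 := abs_le_of_sq_le_sq' (show v.2 ^ 2 ≤ r ^ 2 by nlinarith [sq_nonneg v.1]) hr.le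
  exact ⟨⟨h1.1, h2.1⟩, ⟨h1.2, h2.2⟩⟩

theorem exists_support_point (hb : 0 < b) (hab : b ≤ a) (η : ℝ) :
    ∃ t, a * Real.cos t * Real.cos η + b * Real.sin t * Real.sin η = ellipseSupport a b η := by
  have hpos := ellipseSupport_pos hb hab η
  have hsq := ellipseSupport_sq a b η
  obtain ⟨t, -, h1, h2⟩ := exists_angle (x := a * Real.cos η) (y := b * Real.sin η) hpos
    (by rw [hsq]; ring)
  refine ⟨t, ?_⟩
  have h3 := Real.sin_sq_add_cos_sq t
  linear_combination Real.cos t * h1 + Real.sin t * h2 + ellipseSupport a b η * h3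

/-- The normal at parameter `t` is `(b cos t, a sin t) = D (cos η, sin η)`. Multiplied by `D`, both
sides become `a * b`; for the right one this is seen by comparing squares. -/
theorem exists_normal_angle (hb : 0 < b) (hab : b ≤ a) (t : ℝ) :
    ∃ η, a * Real.cos t * Real.cos η + b * Real.sin t * Real.sin η = ellipseSupport a b η := by
  have ha := hb.trans_le hab
  have hpos := ellipseSupport_pos hb hab (t + Real.pi / 2)
  have hsq := ellipseSupport_sq a b (t + Real.pi / 2)
  rw [Real.cos_add_pi_div_two, Real.sin_add_pi_div_two] at hsq
  generalize ellipseSupport a b (t + Real.pi / 2) = D at *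
  obtain ⟨η, -, h1, h2⟩ := exists_angle (x := b * Real.cos t) (y := a * Real.sin t) hpos
    (by rw [hsq]; ring)
  have h3 := Real.sin_sq_add_cos_sq t
  refine ⟨η, ?_⟩
  have hD : D * (a * Real.cos t * Real.cos η + b * Real.sin t * Real.sin η) = a * b := by
    linear_combination -a * Real.cos t * h1 - b * Real.sin t * h2 + a * b * h3
  have hD2 : (D * ellipseSupport a b η) ^ 2 = (a * b) ^ 2 := by
    rw [mul_pow, ellipseSupport_sq]
    linear_combination -a ^ 2 * (b * Real.cos t + D * Real.cos η) * h1
      - b ^ 2 * (a * Real.sin t + D * Real.sin η) * h2 + a ^ 2 * b ^ 2 * h3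
  have hD3 : D * ellipseSupport a b η = a * b :=
    (pow_left_inj₀ (mul_pos hpos (ellipseSupport_pos hb hab η)).le (by positivity) two_ne_zero).1 hD2
  exact mul_left_cancel₀ hpos.ne' (hD.trans hD3.symm)

/-- A point lies in the elliptic region if and only if it satisfies the support inequalities. -/
theorem mem_ellipticDisk_iff (hb : 0 < b) (hab : b ≤ a) {w v : ℝ × ℝ} :
    v ∈ ellipticDisk a b w ↔ ∀ η, (v.1 - w.1) * Real.cos η + (v.2 - w.2) * Real.sin η
      ≤ ellipseSupport a b η := by
  have ha := hb.trans_le hab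
  simp only [ellipticDisk, mem_ofPred_eq]
  generalize v.1 - w.1 = x
  generalize v.2 - w.2 = y
  constructor
  · intro h η
    apply Real.le_sqrt_of_sq_le
    have e : x * Real.cos η + y * Real.sin η
        = (x / a) * (a * Real.cos η) + (y / b) * (b * Real.sin η) := by field_simp
    rw [e]
    have h0 : 0 ≤ a ^ 2 * Real.cos η ^ 2 + b ^ 2 * Real.sin η ^ 2 := by positivity
    nlinarith [mul_le_mul_of_nonneg_right h h0,
      sq_nonneg ((x / a) * (b * Real.sin η) - (y / b) * (a * Real.cos η))]
  · intro h
    rcases (add_nonneg (sq_nonneg (x / a)) (sq_nonneg (y / b))).eq_or_lt with h0 | h0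
    · linarith
    have hq := Real.sqrt_pos.2 h0
    have hq2 := Real.sq_sqrt h0.le
    -- The vector is `q` times the ellipse point with parameter `t`; testing with the normal `η` at
    -- that point gives `q ≤ 1`.
    obtain ⟨t, -, h1, h2⟩ := exists_angle hq hq2.symm
    obtain ⟨η, hη⟩ := exists_normal_angle hb hab t
    have hpos := ellipseSupport_pos hb hab η
    have h3 := h η
    rw [div_eq_iff ha.ne'] at h1
    rw [div_eq_iff hb.ne'] at h2
    generalize Real.sqrt ((x / a) ^ 2 + (y / b) ^ 2) = q at *
    have h4 : q * ellipseSupport a b η ≤ 1 * ellipseSupport a b η := by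
      rw [one_mul]
      refine le_trans (le_of_eq ?_) h3
      linear_combination -q * hη - Real.cos η * h1 - Real.sin η * h2
    have h5 := le_of_mul_le_mul_right h4 hpos
    rw [← hq2]
    exact pow_le_one₀ hq.le h5

theorem ellipse_dot_le (a b t η : ℝ) :
    a * Real.cos t * Real.cos η + b * Real.sin t * Real.sin η ≤ ellipseSupport a b η := by
  apply Real.le_sqrt_of_sq_le
  have h3 := Real.sin_sq_add_cos_sq t
  have : a ^ 2 * Real.cos η ^ 2 + b ^ 2 * Real.sin η ^ 2
      = (a ^ 2 * Real.cos η ^ 2 + b ^ 2 * Real.sin η ^ 2)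
        * (Real.sin t ^ 2 + Real.cos t ^ 2) := by rw [h3, mul_one]
  rw [this]
  nlinarith [sq_nonneg (a * Real.cos η * Real.sin t - b * Real.sin η * Real.cos t)]

theorem dot_le_of_sq_le (hr : 0 < r) {x y : ℝ} (h : x ^ 2 + y ^ 2 ≤ r ^ 2) (η : ℝ) :
    x * Real.cos η + y * Real.sin η ≤ r := by
  refine le_of_sq_le_sq ?_ hr.le
  nlinarith [Real.sin_sq_add_cos_sq η, sq_nonneg (x * Real.sin η - y * Real.cos η),
    mul_nonneg (add_nonneg (sq_nonneg x) (sq_nonneg y)) (sq_nonneg (Real.cos η))]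

theorem ellipse_add_dot_le (hr : 0 < r) {w : ℝ × ℝ} {t : ℝ} (h : contactFun a b r w t ≤ 0) (η : ℝ) :
    w.1 * Real.cos η + w.2 * Real.sin η
      + (a * Real.cos t * Real.cos η + b * Real.sin t * Real.sin η) ≤ r := by
  have := dot_le_of_sq_le hr (sub_nonpos.1 h) η
  linarith

/-- The ellipse lies in the closed disk if and only if its centre lies in the erosion. -/
theorem mem_erosion_iff (hb : 0 < b) (hab : b ≤ a) (hr : 0 < r) {w : ℝ × ℝ} :
    (w ∈ supportSet fun η => r - ellipseSupport a b η) ↔ ∀ t, contactFun a b r w t ≤ 0 := by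
  constructor
  · intro h t
    have h0 : 0 ≤ (w.1 + a * Real.cos t) ^ 2 + (w.2 + b * Real.sin t) ^ 2 := by positivity
    rw [contactFun, sub_nonpos]
    rcases h0.eq_or_lt with h0 | h0
    · rw [← h0]; positivity
    have hq := Real.sqrt_pos.2 h0
    have hq2 := Real.sq_sqrt h0.le
    obtain ⟨η, -, h1, h2⟩ := exists_angle hq hq2.symm
    have h3 := h η
    have h4 := ellipse_dot_le a b t η
    rw [← hq2]
    generalize Real.sqrt ((w.1 + a * Real.cos t) ^ 2 + (w.2 + b * Real.sin t) ^ 2) = q at *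
    have h5 : q ≤ r := by
      have h6 : q = (w.1 + a * Real.cos t) * Real.cos η + (w.2 + b * Real.sin t) * Real.sin η := by
        linear_combination -q * Real.sin_sq_add_cos_sq η - Real.cos η * h1 - Real.sin η * h2
      simp only at h3
      linarith
    gcongr
  · intro h η
    obtain ⟨t, ht⟩ := exists_support_point hb hab η
    have := ellipse_add_dot_le hr (h t) η
    simp only
    linarith

theorem neg_mem_supportSet {p : ℝ → ℝ} (hp₁ : ∀ η, p (-η) = p η)
    (hp₂ : ∀ η, p (Real.pi - η) = p η) {w : ℝ × ℝ} (h : w ∈ supportSet p) (η : ℝ) :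
    -(w.1 * Real.cos η + w.2 * Real.sin η) ≤ p η := by
  have := neg_fst_mem_supportSet hp₂ (neg_snd_mem_supportSet hp₁ h) η
  simp only at this
  linarith

/-- The circle lies in the closed elliptic region if and only if the centre of the ellipse lies in
the support set with parameter `ellipseSupport a b η - r`. -/
theorem mem_inner_iff (hb : 0 < b) (hab : b ≤ a) (hr : 0 < r) {w : ℝ × ℝ} :
    (w ∈ supportSet fun η => ellipseSupport a b η - r) ↔
      ∀ v : ℝ × ℝ, v.1 ^ 2 + v.2 ^ 2 = r ^ 2 → v ∈ ellipticDisk a b w := by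
  constructor
  · intro h v hv
    rw [mem_ellipticDisk_iff hb hab]
    intro η
    have h1 := neg_mem_supportSet (by simp [ellipseSupport_neg]) (by simp [ellipseSupport_pi_sub])
      h η
    have h2 := dot_le_of_sq_le hr hv.le η
    linarith
  · intro h η
    have h1 := (mem_ellipticDisk_iff hb hab).1 (h (-(r * Real.cos η), -(r * Real.sin η))
      (by simp only; linear_combination r ^ 2 * Real.sin_sq_add_cos_sq η)) (η + Real.pi)
    rw [Real.cos_add_pi, Real.sin_add_pi, ellipseSupport_add_pi] at h1
    simp only at h1 ⊢
    linear_combination h1 - r * Real.sin_sq_add_cos_sq η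

/-- The ellipse point at `t` has component at least `r` along its own normal, so its distance from
the origin is at least `r`. -/
theorem contactFun_nonneg_of_mem_inner (hb : 0 < b) (hab : b ≤ a) (hr : 0 < r) {w : ℝ × ℝ}
    (h : w ∈ supportSet fun η => ellipseSupport a b η - r) (t : ℝ) : 0 ≤ contactFun a b r w t := by
  obtain ⟨η, hη⟩ := exists_normal_angle hb hab t
  have h1 := neg_mem_supportSet (by simp [ellipseSupport_neg]) (by simp [ellipseSupport_pi_sub])
    h η
  have h2 : r ≤ (w.1 + a * Real.cos t) * Real.cos η + (w.2 + b * Real.sin t) * Real.sin η := by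
    linarith
  have h3 : r ^ 2 ≤ ((w.1 + a * Real.cos t) * Real.cos η
    + (w.2 + b * Real.sin t) * Real.sin η) ^ 2 := by gcongr
  rw [contactFun, sub_nonneg]
  refine h3.trans ?_
  generalize w.1 + a * Real.cos t = x
  generalize w.2 + b * Real.sin t = y
  have hcs := Real.sin_sq_add_cos_sq η
  have e : x ^ 2 + y ^ 2 = (x * Real.cos η + y * Real.sin η) ^ 2
      + (x * Real.sin η - y * Real.cos η) ^ 2 := by
    linear_combination -(x ^ 2 + y ^ 2) * hcs
  rw [e]
  exact le_add_of_nonneg_right (sq_nonneg _)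

/-- The centres of the ellipses in direction `0` that meet the circle. -/
def hitSet (a b r : ℝ) : Set (ℝ × ℝ) := {w | ∃ t, contactFun a b r w t = 0}

theorem hitSet_subset_outer (a b : ℝ) (hr : 0 < r) :
    hitSet a b r ⊆ supportSet fun η => ellipseSupport a b η + r := by
  rintro w ⟨t, ht⟩ η
  have h1 := ellipse_add_dot_le hr ht.le η
  have h2 := ellipse_dot_le a b (t + Real.pi) η
  rw [Real.cos_add_pi, Real.sin_add_pi] at h2
  simp only
  linarith

theorem supportSet_mono {p q : ℝ → ℝ} (h : ∀ η, p η ≤ q η) : supportSet p ⊆ supportSet q :=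
  fun _ hw η => (hw η).trans (h η)

/-- A contact of an ellipse inside the closed disk is a maximum of the contact equation, hence a
double zero. -/
theorem hitSet_inter_erosion (hb : 0 < b) (hab : b ≤ a) (hr : 0 < r) :
    (hitSet a b r ∩ supportSet fun η => r - ellipseSupport a b η) ⊆ tangencySet a b r := by
  rintro w ⟨⟨t, ht⟩, h⟩
  refine mem_tangencySet hr ht (IsLocalMax.deriv_eq_zero (Filter.Eventually.of_forall fun s => ?_))
  rw [ht]
  exact (mem_erosion_iff hb hab hr).1 h s

theorem hitSet_inter_inner (hb : 0 < b) (hab : b ≤ a) (hr : 0 < r) :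
    (hitSet a b r ∩ supportSet fun η => ellipseSupport a b η - r) ⊆ tangencySet a b r := by
  rintro w ⟨⟨t, ht⟩, h⟩
  refine mem_tangencySet hr ht (IsLocalMin.deriv_eq_zero (Filter.Eventually.of_forall fun s => ?_))
  rw [ht]
  exact contactFun_nonneg_of_mem_inner hb hab hr h s

theorem exists_of_mem_ellipse (ha : 0 < a) (hb : 0 < b) {w v : ℝ × ℝ}
    (h : ((v.1 - w.1) / a) ^ 2 + ((v.2 - w.2) / b) ^ 2 = 1) :
    ∃ t, v.1 = w.1 + a * Real.cos t ∧ v.2 = w.2 + b * Real.sin t := by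
  obtain ⟨t, -, h1, h2⟩ := exists_angle one_pos (h.trans (one_pow 2).symm)
  rw [div_eq_iff ha.ne'] at h1
  rw [div_eq_iff hb.ne'] at h2
  exact ⟨t, by linarith, by linarith⟩

/-- The closed disk and the elliptic region are not disjoint if the centre lies in the Minkowski
sum. -/
theorem not_disjoint_of_mem_outer (hb : 0 < b) (hab : b ≤ a) (hr : 0 < r) {w : ℝ × ℝ}
    (h : w ∈ supportSet fun η => ellipseSupport a b η + r) :
    ¬ Disjoint (ellipticDisk r r 0) (ellipticDisk a b w) := by
  intro hdis
  have ha := hb.trans_le hab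
  -- A strictly separating functional is `q` times the scalar product with some `(cos η, sin η)`.
  -- Evaluated at the extreme points of both bodies, it contradicts the support inequality at `η`.
  obtain ⟨f, u, v, hu, huv, hv⟩ := geometric_hahn_banach_compact_closed
    (convex_ellipticDisk r r 0) (isCompact_disk hr) (convex_ellipticDisk a b w)
    (isClosed_ellipticDisk a b w) hdis
  have hf : ∀ z : ℝ × ℝ, f z = z.1 * f (1, 0) + z.2 * f (0, 1) := by
    intro z
    rw [← smul_eq_mul, ← smul_eq_mul, ← map_smul, ← map_smul, ← map_add]
    simp
  have hw : w ∈ ellipticDisk a b w := by simp [ellipticDisk]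
  have h0 : (0 : ℝ × ℝ) ∈ ellipticDisk r r 0 := by simp [ellipticDisk]
  have hne : 0 < f (1, 0) ^ 2 + f (0, 1) ^ 2 := by
    rcases (add_nonneg (sq_nonneg (f (1, 0))) (sq_nonneg (f (0, 1)))).eq_or_lt with h1 | h1
    · have e1 : f (1, 0) = 0 := by nlinarith [sq_nonneg (f (1, 0)), sq_nonneg (f (0, 1))]
      have e2 : f (0, 1) = 0 := by nlinarith [sq_nonneg (f (1, 0)), sq_nonneg (f (0, 1))]
      have h2 := hu 0 h0
      have h3 := hv w hw
      rw [hf, e1, e2] at h2 h3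
      simp at h2 h3
      linarith
    · exact h1
  have hq := Real.sqrt_pos.2 hne
  obtain ⟨η, -, h1, h2⟩ := exists_angle hq (Real.sq_sqrt hne.le).symm
  generalize Real.sqrt (f (1, 0) ^ 2 + f (0, 1) ^ 2) = q at *
  have hcs := Real.sin_sq_add_cos_sq η
  have h3 := hu (r * Real.cos η, r * Real.sin η)
    ((mem_disk hr).2 (le_of_eq (by simp only; linear_combination r ^ 2 * hcs)))
  obtain ⟨t, ht⟩ := exists_support_point hb hab η
  have h4 := hv (w.1 - a * Real.cos t, w.2 - b * Real.sin t) (by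
    simp only [ellipticDisk, mem_ofPred_eq, sub_sub_cancel_left, neg_div, neg_sq,
      mul_div_cancel_left₀ _ ha.ne', mul_div_cancel_left₀ _ hb.ne', Real.cos_sq_add_sin_sq, le_refl])
  rw [hf, h1, h2] at h3 h4
  simp only at h3 h4
  have h5 := h η
  simp only at h5
  have h6 : q * r < q * (w.1 * Real.cos η + w.2 * Real.sin η - ellipseSupport a b η) := by
    have e3 : q * r = r * Real.cos η * (q * Real.cos η) + r * Real.sin η * (q * Real.sin η) := by
      linear_combination -q * r * hcs
    have e4 : q * (w.1 * Real.cos η + w.2 * Real.sin η - ellipseSupport a b η)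
        = (w.1 - a * Real.cos t) * (q * Real.cos η) + (w.2 - b * Real.sin t) * (q * Real.sin η) := by
      linear_combination q * ht
    linarith
  have h7 := lt_of_mul_lt_mul_left h6 hq.le
  linarith

/-- Without contact the contact equation has constant sign. If it is not negative, the ellipse
avoids the closed disk; the disk is connected and meets the elliptic region, so it lies inside. -/
theorem outer_subset (hb : 0 < b) (hab : b ≤ a) (hr : 0 < r) :
    (supportSet fun η => ellipseSupport a b η + r) ⊆
      hitSet a b r ∪ (supportSet fun η => r - ellipseSupport a b η)
        ∪ supportSet fun η => ellipseSupport a b η - r := by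
  intro w hw
  have ha := hb.trans_le hab
  by_contra hcon
  simp only [mem_union, not_or] at hcon
  obtain ⟨⟨h1, h2⟩, h3⟩ := hcon
  have hne : ∀ t, contactFun a b r w t ≠ 0 := fun t ht => h1 ⟨t, ht⟩
  have hpos : ∀ t, 0 < contactFun a b r w t := by
    obtain ⟨t₀, ht₀⟩ : ∃ t, 0 < contactFun a b r w t := by
      by_contra hc
      push Not at hc
      exact h2 ((mem_erosion_iff hb hab hr).2 hc)
    intro t
    by_contra ht
    obtain ⟨s, -, hs⟩ := isPreconnected_univ.intermediate_value (mem_univ t) (mem_univ t₀)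
      (continuous_contactFun a b r w).continuousOn ⟨not_lt.1 ht, ht₀.le⟩
    exact hne s hs
  set Q : ℝ × ℝ → ℝ := fun v => ((v.1 - w.1) / a) ^ 2 + ((v.2 - w.2) / b) ^ 2 with hQ
  have hQc : Continuous Q := by fun_prop
  have hQne : ∀ v ∈ ellipticDisk r r 0, Q v ≠ 1 := by
    intro v hv hv1
    obtain ⟨t, e1, e2⟩ := exists_of_mem_ellipse ha hb hv1
    have := hpos t
    rw [contactFun, ← e1, ← e2, sub_pos] at this
    exact absurd ((mem_disk hr).1 hv) (not_le.2 this)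
  obtain ⟨v₀, hv₀, hv₀'⟩ := not_disjoint_iff.1 (not_disjoint_of_mem_outer hb hab hr hw)
  refine h3 ((mem_inner_iff hb hab hr).2 fun v hv => ?_)
  have hvd : v ∈ ellipticDisk r r 0 := (mem_disk hr).2 hv.le
  by_contra hnv
  obtain ⟨z, hz, hz1⟩ := (convex_ellipticDisk r r 0).isPreconnected.intermediate_value hv₀ hvd
    hQc.continuousOn ⟨hv₀', (not_le.1 hnv).le⟩
  exact hQne z hz hz1

/-- One of `b ≤ r` and `r ≤ a` always holds, which makes one of the two widths nonpositive. This
replaces a disjointness argument for the two containment sets. -/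
theorem inner_or_erosion_null (hb : 0 < b) (hab : b ≤ a) (r : ℝ) :
    volume (supportSet fun η => ellipseSupport a b η - r) = 0 ∨
      volume (supportSet fun η => r - ellipseSupport a b η) = 0 := by
  have ha := hb.trans_le hab
  rcases le_total b r with h | h
  · left
    have := hasMeasure_supportSet_zero_of_vertical (p := fun η => ellipseSupport a b η - r)
      (by simp [ellipseSupport, Real.sqrt_sq hb.le, h])
      (by simp [ellipseSupport, Real.sqrt_sq hb.le, h])
    exact ((ENNReal.toReal_eq_zero_iff _).1 this.2.2).resolve_right this.2.1
  · right
    have := hasMeasure_supportSet_zero_of_horizontal (p := fun η => r - ellipseSupport a b η)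
      (by simp [ellipseSupport, Real.sqrt_sq ha.le, h.trans hab])
      (by simp [ellipseSupport, Real.sqrt_sq ha.le, h.trans hab])
    exact ((ENNReal.toReal_eq_zero_iff _).1 this.2.2).resolve_right this.2.1

theorem volume_hitSet_add (hb : 0 < b) (hab : b ≤ a) (hr : 0 < r) :
    volume (hitSet a b r) + volume (supportSet fun η => r - ellipseSupport a b η)
        + volume (supportSet fun η => ellipseSupport a b η - r)
      = volume (supportSet fun η => ellipseSupport a b η + r) := by
  have hU : (supportSet fun η => ellipseSupport a b η + r)
      = hitSet a b r ∪ (supportSet fun η => r - ellipseSupport a b η)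
        ∪ supportSet fun η => ellipseSupport a b η - r := by
    refine (outer_subset hb hab hr).antisymm (union_subset (union_subset
      (hitSet_subset_outer a b hr) (supportSet_mono fun η => ?_)) (supportSet_mono fun η => ?_))
    · linarith [ellipseSupport_pos hb hab η]
    · linarith
  rw [hU, measure_union₀ (isClosed_supportSet _).measurableSet.nullMeasurableSet,
    measure_union₀ (isClosed_supportSet _).measurableSet.nullMeasurableSet]
  · exact measure_mono_null (hitSet_inter_erosion hb hab hr) (volume_tangencySet a b r)
  · rw [AEDisjoint, union_inter_distrib_right]
    refine measure_union_null
      (measure_mono_null (hitSet_inter_inner hb hab hr) (volume_tangencySet a b r)) ?_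
    rcases inner_or_erosion_null hb hab r with h | h
    · exact measure_mono_null inter_subset_right h
    · exact measure_mono_null inter_subset_left h

theorem volume_hitSet (hb : 0 < b) (hab : b ≤ a) (hr : 0 < r) :
    volume (hitSet a b r) ≠ ⊤ ∧ (volume (hitSet a b r)).toReal
      = areaStar a b (-r) - areaEllipseInDisk a b r - areaCircleInEllipse a b r := by
  have h := volume_hitSet_add hb hab hr
  obtain ⟨-, o1, o2⟩ := hasMeasure_outer hb hab hr
  obtain ⟨-, d1, d2⟩ := hasMeasure_ellipseInDisk hb hab hr
  obtain ⟨-, i1, i2⟩ := hasMeasure_circleInEllipse hb hab hr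
  have hH : volume (hitSet a b r) ≠ ⊤ := fun ht => o1 (by rw [← h, ht]; simp)
  refine ⟨hH, ?_⟩
  rw [← o2, ← d2, ← i2, ← h, ENNReal.toReal_add (ENNReal.add_ne_top.2 ⟨hH, d1⟩) i1,
    ENNReal.toReal_add hH d1]
  ring

end

/-! ### Multiplicities and the two linear equations -/

section
variable {a b r : ℝ}

theorem analyticAt_contactFun (a b r : ℝ) (w : ℝ × ℝ) (t : ℝ) :
    AnalyticAt ℝ (contactFun a b r w) t := by
  unfold contactFun
  fun_prop

/-- The number of common points, counted with multiplicity, of the circle about the origin and the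
ellipse in direction `0` with centre `w`. -/
def contactNumber (a b r : ℝ) (w : ℝ × ℝ) : ℕ∞ :=
  ∑' t : Ico (0 : ℝ) (2 * Real.pi), analyticOrderAt (contactFun a b r w) (t : ℝ)

/-- Off the tangency set every zero has order one, so multiplicities play no role almost everywhere.
-/
theorem contactNumber_eq (hr : 0 < r) {w : ℝ × ℝ} (hw : w ∉ tangencySet a b r) :
    contactNumber a b r w
      = ({t ∈ Ico 0 (2 * Real.pi) | contactFun a b r w t = 0}.ncard : ℕ∞) := by
  obtain ⟨hfin, -⟩ := finite_zeros_contactFun hr hw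
  have hord : ∀ t, contactFun a b r w t = 0 → analyticOrderAt (contactFun a b r w) t = 1 :=
    fun t ht => (analyticAt_contactFun a b r w t).analyticOrderAt_eq_one_of_zero_deriv_ne_zero ht
      fun hd => hw (mem_tangencySet hr ht hd)
  have hord' : ∀ t, contactFun a b r w t ≠ 0 → analyticOrderAt (contactFun a b r w) t = 0 :=
    fun t ht => analyticOrderAt_eq_zero.2 (Or.inr ht)
  rw [contactNumber, tsum_subtype (Ico (0 : ℝ) (2 * Real.pi))
      (fun t => analyticOrderAt (contactFun a b r w) t),
    tsum_eq_sum (s := hfin.toFinset), ncard_eq_toFinset_card _ hfin]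
  · rw [Finset.sum_congr rfl (g := fun _ => (1 : ℕ∞))]
    · simp
    · intro t ht
      rw [hfin.mem_toFinset] at ht
      rw [indicator_of_mem ht.1, hord t ht.2]
  · intro t ht
    rw [hfin.mem_toFinset] at ht
    by_cases h : t ∈ Ico 0 (2 * Real.pi)
    · rw [indicator_of_mem h, hord' t fun h0 => ht ⟨h, h0⟩]
    · rw [indicator_of_notMem h]

theorem mem_hitSet_iff (hr : 0 < r) {w : ℝ × ℝ} (hw : w ∉ tangencySet a b r) :
    w ∈ hitSet a b r ↔ {t ∈ Ico 0 (2 * Real.pi) | contactFun a b r w t = 0}.ncard ≠ 0 := by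
  rw [Ne, ncard_eq_zero (finite_zeros_contactFun hr hw).1, ← Ne, ← nonempty_iff_ne_empty]
  constructor
  · rintro ⟨t, ht⟩
    obtain ⟨s, hs, hst⟩ := (contactFun_periodic a b r w).exists_mem_Ico₀ Real.two_pi_pos t
    exact ⟨s, hs, by rw [← hst, ht]⟩
  · rintro ⟨t, -, ht⟩
    exact ⟨t, ht⟩

theorem mul_completeE (hb : 0 < b) (hab : b ≤ a) :
    a * completeE (eccentricity a b) = ∫ θ in (0 : ℝ)..(Real.pi / 2), ellipseSupport a b θ := by
  have ha := hb.trans_le hab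
  simp only [completeE, ellipticE, sqrt_one_sub_eccentricity hb hab,
    intervalIntegral.integral_div]
  field_simp

/-- Almost everywhere the fibre count `N` takes only the values 0, 2 and 4. The area of `hitSet`
gives `v₂ + v₄`, the integral of `N` gives `2 v₂ + 4 v₄`, and the system is solved for both. -/
theorem hasMeasure_contactNumber (hb : 0 < b) (hab : b ≤ a) (hr : 0 < r) :
    HasMeasure volume {w | contactNumber a b r w = 2}
      (2 * Real.pi * r ^ 2 + 2 * Real.pi * a * b
        - 2 * (areaEllipseInDisk a b r + areaCircleInEllipse a b r)) ∧
    HasMeasure volume {w | contactNumber a b r w = 4}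
      (4 * r * a * completeE (eccentricity a b) - Real.pi * r ^ 2 - Real.pi * a * b
        + (areaEllipseInDisk a b r + areaCircleInEllipse a b r)) := by
  obtain ⟨N, hNm, hN, hNint⟩ := exists_measurable_encard_fiber volume
    (hasStrictFDerivAt_contactMap a b r) (continuous_det_contactMapDeriv a b r)
    ((measurableSet_Ico (a := (0 : ℝ)) (b := 2 * Real.pi)).prod
      (measurableSet_Ico (a := (0 : ℝ)) (b := 2 * Real.pi)))
  rw [lintegral_abs_det_contactMapDeriv hb hab hr] at hNint
  have hae : ∀ᵐ w : ℝ × ℝ, w ∉ tangencySet a b r :=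
    measure_eq_zero_iff_ae_notMem.1 (volume_tangencySet a b r)
  have hNn : ∀ w ∉ tangencySet a b r, N w
      = ({t ∈ Ico 0 (2 * Real.pi) | contactFun a b r w t = 0}.ncard : ENNReal) := by
    intro w hw
    rw [hN w hw, encard_contactMap_fiber hr,
      ← (finite_zeros_contactFun hr hw).1.cast_ncard_eq]
    simp
  set A₂ : Set (ℝ × ℝ) := {w | N w = 2} with hA₂
  set A₄ : Set (ℝ × ℝ) := {w | N w = 4} with hA₄
  have hm₂ : MeasurableSet A₂ := hNm (measurableSet_singleton _)
  have hm₄ : MeasurableSet A₄ := hNm (measurableSet_singleton _)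
  have hset : ∀ k : ℕ, ({w | contactNumber a b r w = k} : Set (ℝ × ℝ)) =ᵐ[volume]
      {w | N w = k} := by
    intro k
    rw [Filter.eventuallyEq_set]
    filter_upwards [hae] with w hw
    rw [contactNumber_eq hr hw, hNn w hw, Nat.cast_inj, Nat.cast_inj]
  have hset₂ : ({w | contactNumber a b r w = 2} : Set (ℝ × ℝ)) =ᵐ[volume] A₂ := hset 2
  have hset₄ : ({w | contactNumber a b r w = 4} : Set (ℝ × ℝ)) =ᵐ[volume] A₄ := hset 4
  have hdisj : Disjoint A₂ A₄ := by
    rw [disjoint_left]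
    intro w h2 h4
    rw [hA₂, mem_ofPred_eq] at h2
    rw [hA₄, mem_ofPred_eq, h2] at h4
    norm_num at h4
  have hhit : volume (hitSet a b r) = volume A₂ + volume A₄ := by
    rw [← measure_union hdisj hm₄]
    refine measure_congr ?_
    rw [Filter.eventuallyEq_set]
    filter_upwards [hae] with w hw
    rw [mem_hitSet_iff hr hw, mem_union, hA₂, hA₄, mem_ofPred_eq, mem_ofPred_eq, hNn w hw]
    have := ncard_zeros_contactFun hr hw
    generalize {t ∈ Ico 0 (2 * Real.pi) | contactFun a b r w t = 0}.ncard = n at *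
    simp only [mem_insert_iff, mem_singleton_iff] at this
    rcases this with rfl | rfl | rfl <;> norm_num
  have hint : ∫⁻ w, N w = 2 * volume A₂ + 4 * volume A₄ := by
    have : ∀ᵐ w : ℝ × ℝ, N w = A₂.indicator (fun _ => 2) w + A₄.indicator (fun _ => 4) w := by
      filter_upwards [hae] with w hw
      have h1 := ncard_zeros_contactFun hr hw
      have h2 := hNn w hw
      generalize {t ∈ Ico 0 (2 * Real.pi) | contactFun a b r w t = 0}.ncard = n at *
      simp only [mem_insert_iff, mem_singleton_iff] at h1
      simp only [indicator, hA₂, hA₄, mem_ofPred_eq, h2]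
      rcases h1 with rfl | rfl | rfl <;> norm_num
    rw [lintegral_congr_ae this, lintegral_add_left (measurable_const.indicator hm₂),
      lintegral_indicator_const hm₂, lintegral_indicator_const hm₄]
  obtain ⟨hfin, hval⟩ := volume_hitSet hb hab hr
  have hsum : volume A₂ + volume A₄ ≠ ⊤ := hhit ▸ hfin
  have hf₂ : volume A₂ ≠ ⊤ := (ENNReal.add_ne_top.1 hsum).1
  have hf₄ : volume A₄ ≠ ⊤ := (ENNReal.add_ne_top.1 hsum).2
  have hE := mul_completeE hb hab
  have hI0 : 0 ≤ ∫ θ in (0 : ℝ)..(Real.pi / 2), ellipseSupport a b θ :=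
    intervalIntegral.integral_nonneg (by positivity) fun θ _ => (ellipseSupport_pos hb hab θ).le
  have e1 : (volume A₂).toReal + (volume A₄).toReal
      = areaStar a b (-r) - areaEllipseInDisk a b r - areaCircleInEllipse a b r := by
    rw [← hval, hhit, ENNReal.toReal_add hf₂ hf₄]
  have e2 : 2 * (volume A₂).toReal + 4 * (volume A₄).toReal
      = 16 * r * (a * completeE (eccentricity a b)) := by
    have := congrArg ENNReal.toReal (hint.symm.trans hNint)
    rw [ENNReal.toReal_add (ENNReal.mul_ne_top (by norm_num) hf₂)
      (ENNReal.mul_ne_top (by norm_num) hf₄), ENNReal.toReal_mul, ENNReal.toReal_mul,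
      ENNReal.toReal_ofReal (by positivity), ← hE] at this
    simpa using this
  rw [areaStar_eq hb hab, ← hE] at e1
  refine ⟨⟨hm₂.nullMeasurableSet.congr hset₂.symm, ?_, ?_⟩,
    ⟨hm₄.nullMeasurableSet.congr hset₄.symm, ?_, ?_⟩⟩
  · rwa [measure_congr hset₂]
  · rw [measure_congr hset₂]
    linarith
  · rwa [measure_congr hset₄]
  · rw [measure_congr hset₄]
    linarith

theorem containmentMeasure_eq (hab : b ≤ a) :
    containmentMeasure a b r
      = 2 * Real.pi * (areaEllipseInDisk a b r + areaCircleInEllipse a b r) := by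
  unfold containmentMeasure
  split_ifs with h1 h2
  · rw [areaCircleInEllipse, if_pos (hab.trans h1.le), add_zero]
  · rw [areaCircleInEllipse, if_pos h2, areaEllipseInDisk, if_pos (not_lt.1 h1)]
    simp
  · rw [areaEllipseInDisk, if_pos (not_lt.1 h1), zero_add]

end

/-! ### Reduction from positions to centres in the moving frame -/

/-- The centre of the ellipse in the frame with origin `c` whose first axis is the first axis of
the ellipse. -/
def relativeCentre (c : ℂ) (p : ℂ × ℝ) : ℝ × ℝ :=
  Complex.measurableEquivRealProd (Complex.exp (-(p.2 * Complex.I)) * (p.1 - c))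

theorem measurePreserving_relativeCentre (c : ℂ) (ψ : ℝ) :
    MeasurePreserving (fun M => relativeCentre c (M, ψ)) := by
  have h1 : MeasurePreserving (fun M : ℂ => M - c) := measurePreserving_sub_right volume c
  have h2 : MeasurePreserving (fun M : ℂ => Complex.exp (-(ψ * Complex.I)) * M) := by
    have := (rotation (Circle.exp (-ψ))).measurePreserving
    convert this using 2 with M
    rw [rotation_apply, Circle.coe_exp, Complex.ofReal_neg, neg_mul]
  exact Complex.volume_preserving_equiv_real_prod.comp (h2.comp h1)

theorem hasMeasure_preimage_relativeCentre (c : ℂ) (ψ : ℝ) {S : Set (ℝ × ℝ)} {v : ℝ}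
    (h : HasMeasure volume S v) : HasMeasure volume {M | relativeCentre c (M, ψ) ∈ S} v := by
  have hp := measurePreserving_relativeCentre c ψ
  have hvol : volume {M | relativeCentre c (M, ψ) ∈ S} = volume S := hp.measure_preimage h.1
  exact ⟨h.1.preimage hp.quasiMeasurePreserving, by rw [hvol]; exact h.2.1,
    by rw [hvol]; exact h.2.2⟩

/-- By Fubini it is enough that the map preserves area for each fixed direction. The swaps put the
direction first, as the skew product requires. -/
theorem measurePreserving_relativeCentre_prod (c : ℂ) :
    MeasurePreserving (fun p : ℂ × ℝ => (relativeCentre c p, p.2)) kinematicMeasure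
      ((volume : Measure (ℝ × ℝ)).prod
        ((volume : Measure ℝ).restrict (Ico 0 (2 * Real.pi)))) := by
  have hmeas : Measurable (relativeCentre c) :=
    Complex.measurableEquivRealProd.measurable.comp (by fun_prop)
  have h := (MeasurePreserving.id ((volume : Measure ℝ).restrict
    (Ico 0 (2 * Real.pi)))).skew_product (μc := (volume : Measure ℂ))
    (μd := (volume : Measure (ℝ × ℝ)))
    (g := fun ψ M => relativeCentre c (M, ψ)) (hmeas.comp measurable_swap)
    (Filter.Eventually.of_forall fun ψ => (measurePreserving_relativeCentre c ψ).map_eq)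
  exact (Measure.measurePreserving_swap.comp h).comp Measure.measurePreserving_swap

theorem hasMeasure_kinematicMeasure (c : ℂ) {S : Set (ℝ × ℝ)} {v : ℝ}
    (h : HasMeasure volume S v) :
    HasMeasure kinematicMeasure {p | relativeCentre c p ∈ S} (2 * Real.pi * v) := by
  have hp := measurePreserving_relativeCentre_prod c
  have hS : NullMeasurableSet (S ×ˢ (univ : Set ℝ)) ((volume : Measure (ℝ × ℝ)).prod
      ((volume : Measure ℝ).restrict (Ico 0 (2 * Real.pi)))) :=
    h.1.prod nullMeasurableSet_univ
  have hset : {p | relativeCentre c p ∈ S}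
      = (fun p : ℂ × ℝ => (relativeCentre c p, p.2)) ⁻¹' (S ×ˢ univ) := by
    ext p; simp
  have hvol : kinematicMeasure {p | relativeCentre c p ∈ S}
      = volume S * ENNReal.ofReal (2 * Real.pi) := by
    rw [hset, hp.measure_preimage hS, Measure.prod_prod]
    simp
  refine ⟨hset ▸ hS.preimage hp.quasiMeasurePreserving, ?_, ?_⟩
  · rw [hvol]
    exact ENNReal.mul_ne_top h.2.1 ENNReal.ofReal_ne_top
  · rw [hvol, ENNReal.toReal_mul, h.2.2, ENNReal.toReal_ofReal Real.two_pi_pos.le]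
    ring

/-- Rotation by `-ψ` about `c` preserves distances to `c`, so the equation of the circle on the
ellipse depends only on the relative centre. -/
theorem normSq_ellipsePoint_sub (a b : ℝ) (c : ℂ) (p : ℂ × ℝ) (t : ℝ) :
    Complex.normSq (ellipsePoint a b p t - c)
      = ((relativeCentre c p).1 + a * Real.cos t) ^ 2
        + ((relativeCentre c p).2 + b * Real.sin t) ^ 2 := by
  set z := Complex.exp (-(p.2 * Complex.I)) * (p.1 - c) with hz
  have h1 : ellipsePoint a b p t - c
      = Complex.exp (p.2 * Complex.I) * (z + ⟨a * Real.cos t, b * Real.sin t⟩) := by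
    rw [hz, mul_add, ← mul_assoc, ← Complex.exp_add, add_neg_cancel, Complex.exp_zero,
      ellipsePoint]
    ring
  rw [h1, Complex.normSq_mul, Complex.normSq_eq_norm_sq, Complex.norm_exp_ofReal_mul_I,
    Complex.normSq_apply]
  simp only [Complex.add_re, Complex.add_im]
  change _ = (z.re + _) ^ 2 + (z.im + _) ^ 2
  ring

theorem intersectionNumber_eq (a b r : ℝ) (c : ℂ) (p : ℂ × ℝ) :
    intersectionNumber a b r c p = contactNumber a b r (relativeCentre c p) := by
  simp only [intersectionNumber, contactNumber, normSq_ellipsePoint_sub]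
  rfl

theorem ellipseCurve_subset_iff {a b r : ℝ} (hb : 0 < b) (hab : b ≤ a) (hr : 0 < r) (c : ℂ)
    (p : ℂ × ℝ) : ellipseCurve a b p ⊆ Metric.closedBall c r ↔
      relativeCentre c p ∈ supportSet fun η => r - ellipseSupport a b η := by
  rw [mem_erosion_iff hb hab hr, ellipseCurve, range_subset_iff]
  refine forall_congr' fun t => ?_
  rw [mem_closedBall_iff_norm, contactFun, ← normSq_ellipsePoint_sub, Complex.normSq_eq_norm_sq,
    sub_nonpos, sq_le_sq₀ (norm_nonneg _) hr.le]

theorem mem_ellipseRegion_iff (a b : ℝ) (c : ℂ) (p : ℂ × ℝ) (v : ℂ) :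
    c + Complex.exp (p.2 * Complex.I) * v ∈ ellipseRegion a b p ↔
      (v.re, v.im) ∈ ellipticDisk a b (relativeCentre c p) := by
  set z := Complex.exp (-(p.2 * Complex.I)) * (p.1 - c) with hz
  have hexp : Complex.exp (p.2 * Complex.I) * Complex.exp (-(p.2 * Complex.I)) = 1 := by
    rw [← Complex.exp_add, add_neg_cancel, Complex.exp_zero]
  have hc : c = p.1 - Complex.exp (p.2 * Complex.I) * z := by
    rw [hz, ← mul_assoc, hexp]; ring
  change _ ↔ ((v.re - z.re) / a) ^ 2 + ((v.im - z.im) / b) ^ 2 ≤ 1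
  rw [← Complex.sub_re, ← Complex.sub_im, ellipseRegion]
  constructor
  · rintro ⟨w, hw, h⟩
    have : w = v - z := by
      refine mul_left_cancel₀ (Complex.exp_ne_zero (p.2 * Complex.I)) ?_
      simp only at h
      linear_combination h + hc
    rwa [← this]
  · intro h
    refine ⟨v - z, h, ?_⟩
    simp only
    linear_combination -hc

theorem sphere_subset_iff {a b r : ℝ} (hb : 0 < b) (hab : b ≤ a) (hr : 0 < r) (c : ℂ)
    (p : ℂ × ℝ) : Metric.sphere c r ⊆ ellipseRegion a b p ↔
      relativeCentre c p ∈ supportSet fun η => ellipseSupport a b η - r := by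
  have hexp : Complex.exp (p.2 * Complex.I) * Complex.exp (-(p.2 * Complex.I)) = 1 := by
    rw [← Complex.exp_add, add_neg_cancel, Complex.exp_zero]
  have hnorm : ∀ v : ℂ, ‖v‖ = r ↔ v.re ^ 2 + v.im ^ 2 = r ^ 2 := by
    intro v
    rw [← pow_left_inj₀ (norm_nonneg v) hr.le two_ne_zero, ← Complex.normSq_eq_norm_sq,
      Complex.normSq_apply, sq v.re, sq v.im]
  rw [mem_inner_iff hb hab hr]
  constructor
  · intro h v hv
    refine (mem_ellipseRegion_iff a b c p ⟨v.1, v.2⟩).1 (h ?_)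
    rw [mem_sphere_iff_norm, add_sub_cancel_left, norm_mul, Complex.norm_exp_ofReal_mul_I, one_mul,
      hnorm]
    exact hv
  · intro h v hv
    have hv' : v = c + Complex.exp (p.2 * Complex.I)
        * (Complex.exp (-(p.2 * Complex.I)) * (v - c)) := by
      rw [← mul_assoc, hexp]; ring
    rw [hv', mem_ellipseRegion_iff]
    refine h _ ?_
    simp only
    rw [← hnorm, norm_mul, ← neg_mul, ← Complex.ofReal_neg, Complex.norm_exp_ofReal_mul_I, one_mul]
    exact mem_sphere_iff_norm.1 hv

end

theorem theorem1 (a b r : ℝ) (hb : 0 < b) (hab : b ≤ a) (hr : 0 < r) (c : ℂ) :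
    -- the ellipse meets the circle in two, respectively four, points
    HasMeasure kinematicMeasure {p : ℂ × ℝ | intersectionNumber a b r c p = 2}
      (4 * Real.pi ^ 2 * r ^ 2 + 4 * Real.pi ^ 2 * a * b - 2 * containmentMeasure a b r) ∧
    HasMeasure kinematicMeasure {p : ℂ × ℝ | intersectionNumber a b r c p = 4}
      (8 * Real.pi * r * a * completeE (eccentricity a b) - 2 * Real.pi ^ 2 * r ^ 2
        - 2 * Real.pi ^ 2 * a * b + containmentMeasure a b r) ∧
    -- the ellipse lies in the disk: all directions, and each fixed direction
    HasMeasure kinematicMeasure {p : ℂ × ℝ | ellipseCurve a b p ⊆ Metric.closedBall c r}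
      (2 * Real.pi * areaEllipseInDisk a b r) ∧
    (∀ ψ : ℝ, HasMeasure volume {M : ℂ | ellipseCurve a b (M, ψ) ⊆ Metric.closedBall c r}
      (areaEllipseInDisk a b r)) ∧
    -- the circle lies in the region bounded by the ellipse: likewise
    HasMeasure kinematicMeasure {p : ℂ × ℝ | Metric.sphere c r ⊆ ellipseRegion a b p}
      (2 * Real.pi * areaCircleInEllipse a b r) ∧
    (∀ ψ : ℝ, HasMeasure volume {M : ℂ | Metric.sphere c r ⊆ ellipseRegion a b (M, ψ)}
      (areaCircleInEllipse a b r)) := by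
  obtain ⟨h2, h4⟩ := hasMeasure_contactNumber hb hab hr
  have hD := hasMeasure_ellipseInDisk hb hab hr
  have hI := hasMeasure_circleInEllipse hb hab hr
  simp only [intersectionNumber_eq, ellipseCurve_subset_iff hb hab hr,
    sphere_subset_iff hb hab hr, containmentMeasure_eq hab]
  refine ⟨?_, ?_, hasMeasure_kinematicMeasure c hD,
    fun ψ => hasMeasure_preimage_relativeCentre c ψ hD, hasMeasure_kinematicMeasure c hI,
    fun ψ => hasMeasure_preimage_relativeCentre c ψ hI⟩
  · convert hasMeasure_kinematicMeasure c h2 using 1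
    · rfl
    · ring
  · convert hasMeasure_kinematicMeasure c h4 using 1
    · rfl
    · ring
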